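/- Let $\mathbb K$ be an algebraically closed field, $n>2$ an integer and $q\in\mathbb K$ a primitive $n$-th root of unity. Let $H_n(0,q)$ be the Hopf algebra over $\mathbb K$ generated as an algebra by $a,b,c,d$ subject to the relations $$ba=qab,\quad db=qbd,\quad ca=qac,\quad dc=qcd,\quad bc=cb,\quad a^n=d^n=0,\quad b^n=c^n=1,\quad da=qad,$$ with comultiplication, counit and antipode determined by $$\Delta(a)=a\otimes b+1\otimes a,\quad \Delta(b)=b\otimes b,\quad \Delta(c)=c\otimes c,\quad \Delta(d)=d\otimes c+1\otimes d,$$ $$\varepsilon(a)=\varepsilon(d)=0,\quad \varepsilon(b)=\varepsilon(c)=1,\quad S(a)=-ab^{n-1},\quad S(b)=b^{n-1},\quad S(c)=c^{n-1},\quad S(d)=-dc^{n-1}.$$ The Green ring $r(H)$ of a Hopf algebra $H$ is the abelian group generated by the isomorphism classes $[M]$ of finite-dimensional left $H$-modules modulo the relations $[M\oplus V]=[M]+[V]$, with multiplication $[M][V]=[M\otimes V]$; the projective class ring $r_p(H)$ is the subring of $r(H)$ generated by the classes of the projective modules and of the simple modules. For $i,j\in\mathbb Z/n\mathbb Z$ let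 $S_{i,j}$ be the one-dimensional $H_n(0,q)$-module on which $a$ and $d$ act as $0$, $b$ acts as $q^i$ and $c$ acts as $q^j$; $S_{0,0}$ has a finite-dimensional projective cover, and $P_{0,0}$ denotes any such cover. Then there is a ring isomorphism $$\mathbb Z[x,y,z]\Big/\Big(x^n-1,\ y^n-1,\ z^2-n\sum_{i=0}^{n-1}x^iz\Big)\ \cong\ r_p(H_n(0,q))$$ that sends $x$, $y$ and $z$ to $[S_{1,1}]$, $[S_{0,1}]$ and $[P_{0,0}]$, respectively. -/

import Mathlib

open scoped TensorProduct

universe u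

/-! ## The `q`-binomial formula at a root of unity

It is used only to see that the comultiplication below respects `a ^ n = 0` and `d ^ n = 0`. -/

namespace QBinomial

/-- Gaussian binomial coefficients evaluated at `q`. -/
def gauss {K : Type u} [Field K] (q : K) : ℕ → ℕ → K
  | _, 0 => 1
  | 0, _ + 1 => 0
  | m + 1, k + 1 => gauss q m k + q ^ (k + 1) * gauss q m (k + 1)

theorem gauss_zero_right {K : Type u} [Field K] (q : K) (m : ℕ) : gauss q m 0 = 1 := by
  cases m <;> rfl

theorem gauss_succ {K : Type u} [Field K] (q : K) (m k : ℕ) :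
    gauss q (m + 1) (k + 1) = gauss q m k + q ^ (k + 1) * gauss q m (k + 1) := rfl

theorem gauss_of_lt {K : Type u} [Field K] (q : K) (m : ℕ) :
    ∀ k, m < k → gauss q m k = 0 := by
  induction m with
  | zero =>
    intro k hk
    obtain ⟨j, rfl⟩ : ∃ j, k = j + 1 := ⟨k - 1, by omega⟩
    rfl
  | succ m ih =>
    intro k hk
    obtain ⟨j, rfl⟩ : ∃ j, k = j + 1 := ⟨k - 1, by omega⟩
    rw [gauss_succ, ih j (by omega), ih (j + 1) (by omega)]
    simp

theorem gauss_absorb {K : Type u} [Field K] (q : K) (m : ℕ) :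
    ∀ k, gauss q (m + 1) (k + 1) * (q ^ (k + 1) - 1) = (q ^ (m + 1) - 1) * gauss q m k := by
  induction m with
  | zero =>
    intro k
    rcases k with _ | k
    · rw [gauss_succ, gauss_zero_right, gauss_of_lt q 0 1 (by omega)]; ring
    · rw [gauss_of_lt q 1 (k + 2) (by omega), gauss_of_lt q 0 (k + 1) (by omega)]; ring
  | succ m ih =>
    intro k
    rw [gauss_succ q (m + 1) k, add_mul, mul_assoc, ih k]
    rcases k with _ | k
    · rw [gauss_zero_right, gauss_zero_right]; ring
    · have h1 := ih k
      have h2 := gauss_succ q m k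
      have h3 : q ^ (k + 1 + 1) * ((q ^ (m + 1) - 1) * gauss q m (k + 1)) =
          q * (q ^ (m + 1) - 1) * (gauss q (m + 1) (k + 1) - gauss q m k) := by
        rw [h2]; ring
      rw [h3]
      linear_combination q * h1

theorem gauss_primitive {K : Type u} [Field K] {q : K} {n : ℕ} (hq : IsPrimitiveRoot q n)
    {k : ℕ} (h0 : 0 < k) (hk : k < n) : gauss q n k = 0 := by
  obtain ⟨m, rfl⟩ : ∃ m, n = m + 1 := ⟨n - 1, by omega⟩
  obtain ⟨j, rfl⟩ : ∃ j, k = j + 1 := ⟨k - 1, by omega⟩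
  have h := gauss_absorb q m j
  rw [hq.pow_eq_one, sub_self, zero_mul] at h
  rcases mul_eq_zero.mp h with h | h
  · exact h
  · exact absurd (sub_eq_zero.mp h) (hq.pow_ne_one_of_pos_of_lt (by omega) hk)

theorem mul_pow_skew {K : Type u} [Field K] {A : Type u} [Ring A] [Algebra K A] {q : K} {x y : A}
    (h : y * x = q • (x * y)) (k : ℕ) : y * x ^ k = q ^ k • (x ^ k * y) := by
  induction k with
  | zero => simp
  | succ k ih =>
    rw [pow_succ, ← mul_assoc, ih, smul_mul_assoc, mul_assoc, h, mul_smul_comm, smul_smul,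
      pow_succ, mul_assoc]

theorem add_pow_skew {K : Type u} [Field K] {A : Type u} [Ring A] [Algebra K A] {q : K} {x y : A}
    (h : y * x = q • (x * y)) (m : ℕ) :
    (x + y) ^ m = ∑ k ∈ Finset.range (m + 1), gauss q m k • (x ^ k * y ^ (m - k)) := by
  induction m with
  | zero => simp [gauss_zero_right]
  | succ m ih =>
    rw [pow_succ', ih, add_mul, Finset.mul_sum, Finset.mul_sum]
    have e1 : ∑ k ∈ Finset.range (m + 1), x * gauss q m k • (x ^ k * y ^ (m - k)) =
        ∑ k ∈ Finset.range (m + 1), gauss q m k • (x ^ (k + 1) * y ^ (m - k)) := by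
      refine Finset.sum_congr rfl fun k _ => ?_
      rw [mul_smul_comm, ← mul_assoc, ← pow_succ']
    have e2 : ∑ k ∈ Finset.range (m + 1), y * gauss q m k • (x ^ k * y ^ (m - k)) =
        ∑ k ∈ Finset.range (m + 2), (q ^ k * gauss q m k) • (x ^ k * y ^ (m + 1 - k)) := by
      rw [Finset.sum_range_succ _ (m + 1), gauss_of_lt q m (m + 1) (by omega), mul_zero, zero_smul,
        add_zero]
      refine Finset.sum_congr rfl fun k hk => ?_
      have hk' : k ≤ m := by simpa [Nat.lt_succ_iff] using hk
      rw [mul_smul_comm, ← mul_assoc, mul_pow_skew h, smul_mul_assoc, smul_smul, mul_assoc,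
        ← pow_succ', mul_comm (gauss q m k), show m - k + 1 = m + 1 - k by omega]
    rw [e1, e2, Finset.sum_range_succ' _ (m + 1), Finset.sum_range_succ' _ (m + 1), ← add_assoc,
      ← Finset.sum_add_distrib]
    congr 1
    · refine Finset.sum_congr rfl fun k _ => ?_
      rw [gauss_succ, add_smul, show m + 1 - (k + 1) = m - k by omega]
    · simp [gauss_zero_right]

theorem add_pow_eq_zero {K : Type u} [Field K] {A : Type u} [Ring A] [Algebra K A] {q : K} {n : ℕ}
    (hq : IsPrimitiveRoot q n) {x y : A} (h : y * x = q • (x * y)) (hx : x ^ n = 0)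
    (hy : y ^ n = 0) : (x + y) ^ n = 0 := by
  rw [add_pow_skew h]
  refine Finset.sum_eq_zero fun k hk => ?_
  have hk' : k ≤ n := by simpa [Nat.lt_succ_iff] using hk
  rcases Nat.eq_zero_or_pos k with rfl | h0
  · simp [hy]
  · rcases hk'.lt_or_eq with h1 | rfl
    · rw [gauss_primitive hq h0 h1, zero_smul]
    · simp [hx]

theorem mul_pow_skew_exists {K : Type u} [Field K] {A : Type u} [Ring A] [Algebra K A] {r : K}
    {x y : A} (h : y * x = r • (x * y)) (m : ℕ) : ∃ s : K, (x * y) ^ m = s • (x ^ m * y ^ m) := by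
  induction m with
  | zero => exact ⟨1, by simp⟩
  | succ m ih =>
    obtain ⟨s, hs⟩ := ih
    refine ⟨r ^ m * s, ?_⟩
    rw [pow_succ', hs, mul_smul_comm, mul_assoc, ← mul_assoc y, mul_pow_skew h, smul_mul_assoc,
      mul_smul_comm, smul_smul, mul_comm s, pow_succ' x, pow_succ' y]
    simp only [mul_assoc]

end QBinomial

/-! ## The Hopf algebra `H_n(0,q)` -/

namespace HnZero

/-- The defining relations of `H_n(0,q)` for four elements of a `K`-algebra. -/
structure Relations {K : Type u} [Field K] (n : ℕ) (q : K) {A : Type u} [Ring A] [Algebra K A]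
    (a b c d : A) : Prop where
  ba : b * a = q • (a * b)
  db : d * b = q • (b * d)
  ca : c * a = q • (a * c)
  dc : d * c = q • (c * d)
  bc : b * c = c * b
  an : a ^ n = 0
  bn : b ^ n = 1
  cn : c ^ n = 1
  dn : d ^ n = 0
  da : d * a = q • (a * d)

/-- The names of the four generators. -/
inductive Gen : Type
  | a | b | c | d

open FreeAlgebra in
/-- The relations imposed on the free algebra on `a, b, c, d`. -/
inductive Rel {K : Type u} [Field K] (n : ℕ) (q : K) :
    FreeAlgebra K Gen → FreeAlgebra K Gen → Prop
  | ba : Rel n q (ι K Gen.b * ι K Gen.a) (q • (ι K Gen.a * ι K Gen.b))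
  | db : Rel n q (ι K Gen.d * ι K Gen.b) (q • (ι K Gen.b * ι K Gen.d))
  | ca : Rel n q (ι K Gen.c * ι K Gen.a) (q • (ι K Gen.a * ι K Gen.c))
  | dc : Rel n q (ι K Gen.d * ι K Gen.c) (q • (ι K Gen.c * ι K Gen.d))
  | bc : Rel n q (ι K Gen.b * ι K Gen.c) (ι K Gen.c * ι K Gen.b)
  | an : Rel n q (ι K Gen.a ^ n) 0
  | bn : Rel n q (ι K Gen.b ^ n) 1
  | cn : Rel n q (ι K Gen.c ^ n) 1
  | dn : Rel n q (ι K Gen.d ^ n) 0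
  | da : Rel n q (ι K Gen.d * ι K Gen.a) (q • (ι K Gen.a * ι K Gen.d))

end HnZero

/-- The algebra `H_n(0,q)`: generators `a, b, c, d` and relations
`ba = qab`, `db = qbd`, `ca = qac`, `dc = qcd`, `bc = cb`, `aⁿ = dⁿ = 0`, `bⁿ = cⁿ = 1`,
`da = qad`. -/
def HnZero {K : Type u} [Field K] (n : ℕ) (q : K) : Type u := RingQuot (HnZero.Rel n q)

namespace HnZero

noncomputable section

variable {K : Type u} [Field K] (n : ℕ) (q : K)

instance : Ring (HnZero n q) := inferInstanceAs (Ring (RingQuot (Rel n q)))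

instance instAlgebra : Algebra K (HnZero n q) := inferInstanceAs (Algebra K (RingQuot (Rel n q)))

/-- The image of a generator. -/
def gen (g : Gen) : HnZero n q := RingQuot.mkAlgHom K (Rel n q) (FreeAlgebra.ι K g)

theorem relations :
    Relations n q (gen n q Gen.a) (gen n q Gen.b) (gen n q Gen.c) (gen n q Gen.d) := by
  constructor
  · have h := RingQuot.mkAlgHom_rel K (Rel.ba (n := n) (q := q))
    rw [map_smul, map_mul, map_mul] at h; exact h
  · have h := RingQuot.mkAlgHom_rel K (Rel.db (n := n) (q := q))
    rw [map_smul, map_mul, map_mul] at h; exact h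
  · have h := RingQuot.mkAlgHom_rel K (Rel.ca (n := n) (q := q))
    rw [map_smul, map_mul, map_mul] at h; exact h
  · have h := RingQuot.mkAlgHom_rel K (Rel.dc (n := n) (q := q))
    rw [map_smul, map_mul, map_mul] at h; exact h
  · have h := RingQuot.mkAlgHom_rel K (Rel.bc (n := n) (q := q))
    rw [map_mul, map_mul] at h; exact h
  · have h := RingQuot.mkAlgHom_rel K (Rel.an (n := n) (q := q))
    rw [map_pow, map_zero] at h; exact h
  · have h := RingQuot.mkAlgHom_rel K (Rel.bn (n := n) (q := q))
    rw [map_pow, map_one] at h; exact h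
  · have h := RingQuot.mkAlgHom_rel K (Rel.cn (n := n) (q := q))
    rw [map_pow, map_one] at h; exact h
  · have h := RingQuot.mkAlgHom_rel K (Rel.dn (n := n) (q := q))
    rw [map_pow, map_zero] at h; exact h
  · have h := RingQuot.mkAlgHom_rel K (Rel.da (n := n) (q := q))
    rw [map_smul, map_mul, map_mul] at h; exact h

variable {n q}

/-- The images of the generators under the map of free algebras. -/
def genMap {A : Type u} (a b c d : A) : Gen → A
  | .a => a
  | .b => b
  | .c => c
  | .d => d

/-- The universal property of `H_n(0,q)`. -/
def lift {A : Type u} [Ring A] [Algebra K A] {a b c d : A} (h : Relations n q a b c d) :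
    HnZero n q →ₐ[K] A :=
  RingQuot.liftAlgHom K ⟨FreeAlgebra.lift K (genMap a b c d), by
    rintro _ _ (_ | _)
    · simpa [genMap] using h.ba
    · simpa [genMap] using h.db
    · simpa [genMap] using h.ca
    · simpa [genMap] using h.dc
    · simpa [genMap] using h.bc
    · simpa [genMap] using h.an
    · simpa [genMap] using h.bn
    · simpa [genMap] using h.cn
    · simpa [genMap] using h.dn
    · simpa [genMap] using h.da⟩

@[simp]
theorem lift_gen {A : Type u} [Ring A] [Algebra K A] {a b c d : A} (h : Relations n q a b c d)
    (g : Gen) : lift h (gen n q g) = genMap a b c d g := by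
  unfold lift gen
  erw [RingQuot.liftAlgHom_mkAlgHom_apply]
  simp

theorem hom_ext {A : Type u} [Ring A] [Algebra K A] {f g : HnZero n q →ₐ[K] A}
    (h : ∀ x, f (gen n q x) = g (gen n q x)) : f = g := by
  refine RingQuot.ringQuot_ext' K f g (FreeAlgebra.hom_ext (funext fun x => ?_))
  exact h x

/-- Every subalgebra containing the four generators is everything. -/
theorem eq_top_of_gen_mem (B : Subalgebra K (HnZero n q)) (h : ∀ g, gen n q g ∈ B) : B = ⊤ := by
  have hB : Relations n q (⟨_, h .a⟩ : B) ⟨_, h .b⟩ ⟨_, h .c⟩ ⟨_, h .d⟩ := by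
    have r := relations n q
    exact ⟨Subtype.ext r.ba, Subtype.ext r.db, Subtype.ext r.ca, Subtype.ext r.dc,
      Subtype.ext r.bc, Subtype.ext r.an, Subtype.ext r.bn, Subtype.ext r.cn, Subtype.ext r.dn,
      Subtype.ext r.da⟩
  have e : B.val.comp (lift hB) = AlgHom.id K _ := hom_ext fun x => by
    cases x <;> simp [genMap]
  refine eq_top_iff.mpr fun x _ => ?_
  have := DFunLike.congr_fun e x
  simp only [AlgHom.comp_apply, AlgHom.id_apply] at this
  rw [← this]
  exact (lift hB x).2

open TensorProduct in
theorem relations_comul (hq : IsPrimitiveRoot q n) :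
    Relations n q (A := HnZero n q ⊗[K] HnZero n q)
      (gen n q .a ⊗ₜ gen n q .b + 1 ⊗ₜ gen n q .a) (gen n q .b ⊗ₜ gen n q .b)
      (gen n q .c ⊗ₜ gen n q .c) (gen n q .d ⊗ₜ gen n q .c + 1 ⊗ₜ gen n q .d) := by
  have r := relations n q
  constructor
  · simp only [mul_add, add_mul, Algebra.TensorProduct.tmul_mul_tmul, r.ba, smul_add, mul_one,
      one_mul, tmul_smul, smul_tmul']
  · simp only [mul_add, add_mul, Algebra.TensorProduct.tmul_mul_tmul, r.db, r.bc, smul_add,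
      mul_one, one_mul, tmul_smul, smul_tmul']
  · simp only [mul_add, add_mul, Algebra.TensorProduct.tmul_mul_tmul, r.ca, r.bc, smul_add,
      mul_one, one_mul, tmul_smul, smul_tmul']
  · simp only [mul_add, add_mul, Algebra.TensorProduct.tmul_mul_tmul, r.dc, smul_add,
      mul_one, one_mul, tmul_smul, smul_tmul']
  · simp only [Algebra.TensorProduct.tmul_mul_tmul, r.bc]
  · rw [add_comm]
    refine QBinomial.add_pow_eq_zero hq ?_ ?_ ?_
    · simp only [Algebra.TensorProduct.tmul_mul_tmul, r.ba, mul_one, one_mul, tmul_smul]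
    · rw [Algebra.TensorProduct.tmul_pow, r.an, tmul_zero]
    · rw [Algebra.TensorProduct.tmul_pow, r.an, zero_tmul]
  · rw [Algebra.TensorProduct.tmul_pow, r.bn]; rfl
  · rw [Algebra.TensorProduct.tmul_pow, r.cn]; rfl
  · refine QBinomial.add_pow_eq_zero hq ?_ ?_ ?_
    · simp only [Algebra.TensorProduct.tmul_mul_tmul, r.dc, mul_one, one_mul, tmul_smul]
    · rw [Algebra.TensorProduct.tmul_pow, r.dn, zero_tmul]
    · rw [Algebra.TensorProduct.tmul_pow, r.dn, tmul_zero]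
  · simp only [mul_add, add_mul, Algebra.TensorProduct.tmul_mul_tmul, r.da, r.bc, r.ca, r.db,
      smul_add, mul_one, one_mul, tmul_smul, smul_tmul']
    abel

/-- The scalars `0, s, t, 0` satisfy the relations when `s ^ n = t ^ n = 1`. -/
theorem relations_scalar (hn : n ≠ 0) {s t : K} (hs : s ^ n = 1) (ht : t ^ n = 1) :
    Relations n q (0 : K) s t 0 := by
  constructor <;> simp [hn, hs, ht, mul_comm]

variable [hn : Fact (2 < n)] [hq : Fact (IsPrimitiveRoot q n)]

variable (n q) in
/-- The comultiplication: `Δ(a) = a ⊗ b + 1 ⊗ a`, `Δ(b) = b ⊗ b`, `Δ(c) = c ⊗ c`,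
`Δ(d) = d ⊗ c + 1 ⊗ d`. -/
def comulHom : HnZero n q →ₐ[K] HnZero n q ⊗[K] HnZero n q := lift (relations_comul hq.out)

theorem ne_zero_of_fact : n ≠ 0 := by
  have := hn.out
  omega

variable (n q) in
/-- The counit: `ε(a) = ε(d) = 0`, `ε(b) = ε(c) = 1`. -/
def counitHom : HnZero n q →ₐ[K] K :=
  lift (relations_scalar ne_zero_of_fact (one_pow n) (one_pow n))

instance instBialgebra : Bialgebra K (HnZero n q) :=
  Bialgebra.ofAlgHom (comulHom n q) (counitHom n q)
    (hom_ext fun x => by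
      cases x <;> simp [comulHom, genMap, TensorProduct.add_tmul, TensorProduct.tmul_add,
        Algebra.TensorProduct.one_def, add_assoc])
    (hom_ext fun x => by cases x <;> simp [comulHom, counitHom, genMap])
    (hom_ext fun x => by cases x <;> simp [comulHom, counitHom, genMap])

theorem comul_gen (g : Gen) : Coalgebra.comul (R := K) (gen n q g) =
    genMap (gen n q .a ⊗ₜ[K] gen n q .b + 1 ⊗ₜ[K] gen n q .a) (gen n q .b ⊗ₜ[K] gen n q .b)
      (gen n q .c ⊗ₜ[K] gen n q .c) (gen n q .d ⊗ₜ[K] gen n q .c + 1 ⊗ₜ[K] gen n q .d) g :=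
  lift_gen (relations_comul hq.out) g

theorem counit_gen (g : Gen) : Coalgebra.counit (R := K) (gen n q g) = genMap 0 1 1 0 g :=
  lift_gen (relations_scalar ne_zero_of_fact (one_pow n) (one_pow n)) g

section Antipode

open MulOpposite

variable (n q) in
/-- The elements `S(a) = -a b^{n-1}`, `S(b) = b^{n-1}`, `S(c) = c^{n-1}`, `S(d) = -d c^{n-1}`
satisfy the relations in the opposite algebra. -/
theorem relations_antipode :
    Relations n q (op (-(gen n q .a * gen n q .b ^ (n - 1)))) (op (gen n q .b ^ (n - 1)))
      (op (gen n q .c ^ (n - 1))) (op (-(gen n q .d * gen n q .c ^ (n - 1)))) := by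
  have hn0 : n ≠ 0 := ne_zero_of_fact
  have r := relations n q
  generalize gen n q .a = a, gen n q .b = b, gen n q .c = c, gen n q .d = d at r
  obtain ⟨β, hβ⟩ : ∃ β, β = b ^ (n - 1) := ⟨_, rfl⟩
  obtain ⟨γ, hγ⟩ : ∃ γ, γ = c ^ (n - 1) := ⟨_, rfl⟩
  rw [← hβ, ← hγ]
  have b1 : b * β = 1 := by rw [hβ, mul_pow_sub_one hn0, r.bn]
  have b2 : β * b = 1 := by rw [hβ, pow_sub_one_mul hn0, r.bn]
  have c1 : c * γ = 1 := by rw [hγ, mul_pow_sub_one hn0, r.cn]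
  have c2 : γ * c = 1 := by rw [hγ, pow_sub_one_mul hn0, r.cn]
  have βγ : β * γ = γ * β := by
    rw [hβ, hγ]; exact ((show Commute b c from r.bc).pow_pow _ _).eq
  have βn : β ^ n = 1 := by rw [hβ, ← pow_mul, mul_comm, pow_mul, r.bn, one_pow]
  have γn : γ ^ n = 1 := by rw [hγ, ← pow_mul, mul_comm, pow_mul, r.cn, one_pow]
  have conj : ∀ (u v w : HnZero n q), u * v = 1 → v * u = 1 → u * w = q • (w * u) →
      w * v = q • (v * w) := by
    intro u v w h1 h2 h
    calc w * v = v * (u * w) * v := by rw [← mul_assoc, h2, one_mul]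
      _ = q • (v * w * (u * v)) := by
        rw [h, mul_smul_comm, smul_mul_assoc]; simp only [mul_assoc]
      _ = q • (v * w) := by rw [h1, mul_one]
  have conj' : ∀ (u v w : HnZero n q), u * v = 1 → v * u = 1 → w * u = q • (u * w) →
      v * w = q • (w * v) := by
    intro u v w h1 h2 h
    calc v * w = v * (w * u) * v := by rw [mul_assoc, mul_assoc, h1, mul_one]
      _ = q • (v * u * w * v) := by
        rw [h, mul_smul_comm, smul_mul_assoc]; simp only [mul_assoc]
      _ = q • (w * v) := by rw [h2, one_mul]
  have aβ := conj b β a b1 b2 r.ba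
  have aγ := conj c γ a c1 c2 r.ca
  have βd := conj' b β d b1 b2 r.db
  have γd := conj' c γ d c1 c2 r.dc
  have q0 : q ≠ 0 := hq.out.ne_zero hn0
  have pa : (-(a * β)) ^ n = 0 := by
    have h : β * a = q⁻¹ • (a * β) := by rw [aβ, smul_smul, inv_mul_cancel₀ q0, one_smul]
    obtain ⟨s, hs⟩ := QBinomial.mul_pow_skew_exists h n
    rw [neg_pow, hs, r.an, zero_mul, smul_zero, mul_zero]
  have pd : (-(d * γ)) ^ n = 0 := by
    obtain ⟨s, hs⟩ := QBinomial.mul_pow_skew_exists γd n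
    rw [neg_pow, hs, r.dn, zero_mul, smul_zero, mul_zero]
  constructor
  · rw [← op_mul, ← op_mul, ← op_smul, neg_mul, mul_neg, smul_neg, aβ, mul_smul_comm,
      smul_mul_assoc, mul_assoc, aβ, mul_smul_comm]
  · rw [← op_mul, ← op_mul, ← op_smul, neg_mul, mul_neg, smul_neg, ← mul_assoc, βd,
      smul_mul_assoc, mul_assoc, mul_assoc, βγ]
  · rw [← op_mul, ← op_mul, ← op_smul, neg_mul, mul_neg, smul_neg, mul_assoc, βγ, ← mul_assoc,
      ← mul_assoc, aγ, smul_mul_assoc]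
  · rw [← op_mul, ← op_mul, ← op_smul, neg_mul, mul_neg, smul_neg, ← mul_assoc, γd,
      smul_mul_assoc]
  · rw [← op_mul, ← op_mul, βγ]
  · rw [← op_pow, pa, op_zero]
  · rw [← op_pow, βn, op_one]
  · rw [← op_pow, γn, op_one]
  · rw [← op_pow, pd, op_zero]
  · rw [← op_mul, ← op_mul, ← op_smul, neg_mul_neg, neg_mul_neg]
    congr 1
    calc a * β * (d * γ) = a * (β * d) * γ := by simp only [mul_assoc]
      _ = q • (a * d * (β * γ)) := by
        rw [βd, mul_smul_comm, smul_mul_assoc]; simp only [mul_assoc]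
      _ = d * a * (γ * β) := by rw [r.da, βγ, smul_mul_assoc]
      _ = d * (a * γ) * β := by simp only [mul_assoc]
      _ = q • (d * γ * (a * β)) := by
        rw [aγ, mul_smul_comm, smul_mul_assoc]; simp only [mul_assoc]

variable (n q) in
/-- The antipode. -/
def antipodeMap : HnZero n q →ₗ[K] HnZero n q :=
  (opLinearEquiv K).symm.toLinearMap ∘ₗ (lift (relations_antipode n q)).toLinearMap

theorem antipodeMap_mul (x y : HnZero n q) :
    antipodeMap n q (x * y) = antipodeMap n q y * antipodeMap n q x := by
  simp [antipodeMap]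

theorem antipodeMap_one : antipodeMap n q 1 = 1 := by simp [antipodeMap]

theorem antipodeMap_gen (g : Gen) : antipodeMap n q (gen n q g) =
    genMap (-(gen n q .a * gen n q .b ^ (n - 1))) (gen n q .b ^ (n - 1)) (gen n q .c ^ (n - 1))
      (-(gen n q .d * gen n q .c ^ (n - 1))) g := by
  cases g <;> simp [antipodeMap, genMap]

variable (n q) in
/-- The map `x ⊗ y ↦ S(x) y`. -/
def antiL : HnZero n q ⊗[K] HnZero n q →ₗ[K] HnZero n q :=
  LinearMap.mul' K _ ∘ₗ (antipodeMap n q).rTensor _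

variable (n q) in
/-- The map `x ⊗ y ↦ x S(y)`. -/
def antiR : HnZero n q ⊗[K] HnZero n q →ₗ[K] HnZero n q :=
  LinearMap.mul' K _ ∘ₗ (antipodeMap n q).lTensor _

theorem antiL_tmul (x y : HnZero n q) : antiL n q (x ⊗ₜ y) = antipodeMap n q x * y := rfl

theorem antiR_tmul (x y : HnZero n q) : antiR n q (x ⊗ₜ y) = x * antipodeMap n q y := rfl

theorem antiL_mul_tmul (s : HnZero n q ⊗[K] HnZero n q) (x y : HnZero n q) :
    antiL n q (s * x ⊗ₜ y) = antipodeMap n q x * antiL n q s * y := by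
  induction s with
  | zero => simp
  | add s s' hs hs' => simp only [add_mul, mul_add, map_add, hs, hs']
  | tmul g h =>
    simp only [Algebra.TensorProduct.tmul_mul_tmul, antiL_tmul, antipodeMap_mul, mul_assoc]

theorem antiR_tmul_mul (s : HnZero n q ⊗[K] HnZero n q) (x y : HnZero n q) :
    antiR n q (x ⊗ₜ y * s) = x * antiR n q s * antipodeMap n q y := by
  induction s with
  | zero => simp
  | add s s' hs hs' => simp only [add_mul, mul_add, map_add, hs, hs']
  | tmul g h =>
    simp only [Algebra.TensorProduct.tmul_mul_tmul, antiR_tmul, antipodeMap_mul, mul_assoc]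

theorem antiL_mul {s : HnZero n q ⊗[K] HnZero n q} {k : K}
    (hs : antiL n q s = algebraMap K _ k) (t : HnZero n q ⊗[K] HnZero n q) :
    antiL n q (s * t) = k • antiL n q t := by
  induction t with
  | zero => simp
  | add t t' ht ht' => simp only [mul_add, map_add, ht, ht', smul_add]
  | tmul x y =>
    rw [antiL_mul_tmul, hs, antiL_tmul, ← Algebra.commutes, mul_assoc, Algebra.smul_def]

theorem antiR_mul {t : HnZero n q ⊗[K] HnZero n q} {k : K}
    (ht : antiR n q t = algebraMap K _ k) (s : HnZero n q ⊗[K] HnZero n q) :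
    antiR n q (s * t) = k • antiR n q s := by
  induction s with
  | zero => simp
  | add s s' hs hs' => simp only [add_mul, map_add, hs, hs', smul_add]
  | tmul x y =>
    rw [antiR_tmul_mul, ht, antiR_tmul, ← Algebra.commutes, mul_assoc, Algebra.smul_def]

theorem antiL_comul (x : HnZero n q) :
    antiL n q (Coalgebra.comul (R := K) x) = algebraMap K _ (Coalgebra.counit (R := K) x) := by
  let B : Subalgebra K (HnZero n q) :=
    { carrier := {x | antiL n q (Coalgebra.comul (R := K) x) =
        algebraMap K _ (Coalgebra.counit (R := K) x)}
      mul_mem' := fun {x y} hx hy => by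
        rw [Set.mem_ofPred_eq] at hx hy ⊢
        rw [Bialgebra.comul_mul, Bialgebra.counit_mul, antiL_mul hx, hy, map_mul, Algebra.smul_def]
      add_mem' := fun {x y} hx hy => by
        rw [Set.mem_ofPred_eq] at hx hy ⊢
        rw [map_add, map_add, map_add, map_add, hx, hy]
      algebraMap_mem' := fun k => by
        rw [Set.mem_ofPred_eq, Bialgebra.comul_algebraMap, Bialgebra.counit_algebraMap,
          Algebra.algebraMap_eq_smul_one, map_smul, Algebra.TensorProduct.one_def, antiL_tmul,
          antipodeMap_one, mul_one, Algebra.algebraMap_eq_smul_one] }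
  have hB : B = ⊤ := eq_top_of_gen_mem B fun g => by
    have r := relations n q
    have hn0 : n ≠ 0 := ne_zero_of_fact
    change antiL n q (Coalgebra.comul (R := K) (gen n q g)) =
      algebraMap K _ (Coalgebra.counit (R := K) (gen n q g))
    rw [comul_gen, counit_gen]
    cases g
    · simp only [genMap, map_add, antiL_tmul, antipodeMap_gen, antipodeMap_one, neg_mul, mul_assoc,
        pow_sub_one_mul hn0, r.bn, mul_one, one_mul, map_zero, neg_add_cancel]
    · simp only [genMap, antiL_tmul, antipodeMap_gen, pow_sub_one_mul hn0, r.bn, map_one]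
    · simp only [genMap, antiL_tmul, antipodeMap_gen, pow_sub_one_mul hn0, r.cn, map_one]
    · simp only [genMap, map_add, antiL_tmul, antipodeMap_gen, antipodeMap_one, neg_mul, mul_assoc,
        pow_sub_one_mul hn0, r.cn, mul_one, one_mul, map_zero, neg_add_cancel]
  exact (hB ▸ Algebra.mem_top : x ∈ B)

theorem antiR_comul (x : HnZero n q) :
    antiR n q (Coalgebra.comul (R := K) x) = algebraMap K _ (Coalgebra.counit (R := K) x) := by
  let B : Subalgebra K (HnZero n q) :=
    { carrier := {x | antiR n q (Coalgebra.comul (R := K) x) =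
        algebraMap K _ (Coalgebra.counit (R := K) x)}
      mul_mem' := fun {x y} hx hy => by
        rw [Set.mem_ofPred_eq] at hx hy ⊢
        rw [Bialgebra.comul_mul, Bialgebra.counit_mul, antiR_mul hy, hx, mul_comm, map_mul,
          Algebra.smul_def]
      add_mem' := fun {x y} hx hy => by
        rw [Set.mem_ofPred_eq] at hx hy ⊢
        rw [map_add, map_add, map_add, map_add, hx, hy]
      algebraMap_mem' := fun k => by
        rw [Set.mem_ofPred_eq, Bialgebra.comul_algebraMap, Bialgebra.counit_algebraMap,
          Algebra.algebraMap_eq_smul_one, map_smul, Algebra.TensorProduct.one_def, antiR_tmul,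
          antipodeMap_one, mul_one, Algebra.algebraMap_eq_smul_one] }
  have hB : B = ⊤ := eq_top_of_gen_mem B fun g => by
    have r := relations n q
    have hn0 : n ≠ 0 := ne_zero_of_fact
    change antiR n q (Coalgebra.comul (R := K) (gen n q g)) =
      algebraMap K _ (Coalgebra.counit (R := K) (gen n q g))
    rw [comul_gen, counit_gen]
    cases g
    · simp only [genMap, map_add, antiR_tmul, antipodeMap_gen, one_mul, map_zero, add_neg_cancel]
    · simp only [genMap, antiR_tmul, antipodeMap_gen, mul_pow_sub_one hn0, r.bn, map_one]
    · simp only [genMap, antiR_tmul, antipodeMap_gen, mul_pow_sub_one hn0, r.cn, map_one]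
    · simp only [genMap, map_add, antiR_tmul, antipodeMap_gen, one_mul, map_zero, add_neg_cancel]
  exact (hB ▸ Algebra.mem_top : x ∈ B)

/-- `H_n(0,q)` is a Hopf algebra. -/
instance instHopfAlgebra : HopfAlgebra K (HnZero n q) where
  antipode := antipodeMap n q
  mul_antipode_rTensor_comul := LinearMap.ext antiL_comul
  mul_antipode_lTensor_comul := LinearMap.ext antiR_comul

end Antipode

end

end HnZero

/-! ## Finite-dimensional modules over a bialgebra, and their tensor products -/

/-- A finite-dimensional left module over a `K`-algebra `H`. -/
structure FDModule (K H : Type u) [Field K] [Ring H] [Algebra K H] where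
  carrier : Type u
  [addCommGroup : AddCommGroup carrier]
  [moduleK : Module K carrier]
  [moduleH : Module H carrier]
  [isScalarTower : IsScalarTower K H carrier]
  [finite : Module.Finite K carrier]

namespace FDModule

noncomputable section

attribute [instance] addCommGroup moduleK moduleH isScalarTower finite

section Algebra

variable {K H : Type u} [Field K] [Ring H] [Algebra K H]

instance : CoeSort (FDModule K H) (Type u) := ⟨carrier⟩

/-- The direct sum of two modules. -/
def directSum (M N : FDModule K H) : FDModule K H := ⟨M × N⟩

/-- The underlying space of the one-dimensional module given by a character. -/
def CharSpace (_χ : H →ₐ[K] K) : Type u := K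

instance (χ : H →ₐ[K] K) : AddCommGroup (CharSpace χ) := inferInstanceAs (AddCommGroup K)

instance (χ : H →ₐ[K] K) : Module K (CharSpace χ) := inferInstanceAs (Module K K)

instance (χ : H →ₐ[K] K) : Module.Finite K (CharSpace χ) := inferInstanceAs (Module.Finite K K)

instance (χ : H →ₐ[K] K) : Module H (CharSpace χ) := Module.compHom K χ.toRingHom

theorem char_smul_def (χ : H →ₐ[K] K) (h : H) (x : CharSpace χ) :
    h • x = (χ h • x : CharSpace χ) := rfl

instance (χ : H →ₐ[K] K) : IsScalarTower K H (CharSpace χ) :=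
  ⟨fun k h x => by rw [char_smul_def, char_smul_def, map_smul, smul_assoc]⟩

/-- The one-dimensional module on which `h` acts as the scalar `χ h`. -/
def char (χ : H →ₐ[K] K) : FDModule K H := ⟨CharSpace χ⟩

/-- `P` is a projective cover of `M`: it is projective and there is an epimorphism `P → M` with
superfluous kernel. -/
def IsProjectiveCover (P M : FDModule K H) : Prop :=
  Module.Projective H P ∧ ∃ f : P →ₗ[H] M, Function.Surjective f ∧
    ∀ N : Submodule H P, N ⊔ LinearMap.ker f = ⊤ → N = ⊤

variable (K H) in
/-- Isomorphism of modules. -/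
instance isoSetoid : Setoid (FDModule K H) where
  r M N := Nonempty (M ≃ₗ[H] N)
  iseqv := ⟨fun _ => ⟨.refl _ _⟩, fun ⟨e⟩ => ⟨e.symm⟩, fun ⟨e⟩ ⟨f⟩ => ⟨e.trans f⟩⟩

end Algebra

section Actions

variable {K H : Type u} [Field K] [Ring H] {U V W : Type u} [AddCommGroup U] [Module K U]
  [AddCommGroup V] [Module K V] [AddCommGroup W] [Module K W]

/-- The action of `H ⊗ H` on `V ⊗ W`, given actions of `H` on `V` and `W`. -/
def act₂ [Algebra K H] (ρ : H →ₐ[K] Module.End K V) (σ : H →ₐ[K] Module.End K W) :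
    H ⊗[K] H →ₐ[K] Module.End K (V ⊗[K] W) :=
  (Module.endTensorEndAlgHom (R := K) (S := K) (A := K)).comp (Algebra.TensorProduct.map ρ σ)

theorem act₂_tmul [Algebra K H] (ρ : H →ₐ[K] Module.End K V) (σ : H →ₐ[K] Module.End K W)
    (g h : H) (x : V) (y : W) : act₂ ρ σ (g ⊗ₜ h) (x ⊗ₜ y) = ρ g x ⊗ₜ σ h y := rfl

/-- The action of `H` on `V ⊗ W` through the comultiplication. -/
def tensorRep [Bialgebra K H] (ρ : H →ₐ[K] Module.End K V) (σ : H →ₐ[K] Module.End K W) :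
    H →ₐ[K] Module.End K (V ⊗[K] W) :=
  (act₂ ρ σ).comp (Bialgebra.comulAlgHom K H)

theorem tensorRep_apply [Bialgebra K H] (ρ : H →ₐ[K] Module.End K V)
    (σ : H →ₐ[K] Module.End K W) (h : H) :
    tensorRep ρ σ h = act₂ ρ σ (Coalgebra.comul (R := K) h) := rfl

theorem act₂_congr [Algebra K H] {V' W' : Type u} [AddCommGroup V'] [Module K V']
    [AddCommGroup W'] [Module K W'] {ρ : H →ₐ[K] Module.End K V} {σ : H →ₐ[K] Module.End K W}
    {ρ' : H →ₐ[K] Module.End K V'} {σ' : H →ₐ[K] Module.End K W'} (e : V ≃ₗ[K] V')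
    (f : W ≃ₗ[K] W') (he : ∀ h x, e (ρ h x) = ρ' h (e x)) (hf : ∀ h x, f (σ h x) = σ' h (f x))
    (s : H ⊗[K] H) (t : V ⊗[K] W) :
    TensorProduct.congr e f (act₂ ρ σ s t) = act₂ ρ' σ' s (TensorProduct.congr e f t) := by
  induction s with
  | zero => simp
  | add s s' hs hs' => simp only [map_add, LinearMap.add_apply, hs, hs']
  | tmul g h =>
    induction t with
    | zero => simp
    | add t t' ht ht' => simp only [map_add, ht, ht']
    | tmul x y => simp only [act₂_tmul, TensorProduct.congr_tmul, he, hf]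

/-- The action of `H ⊗ (H ⊗ H)` on `U ⊗ (V ⊗ W)`. -/
def act₃ [Algebra K H] (τ : H →ₐ[K] Module.End K U) (ρ : H →ₐ[K] Module.End K V)
    (σ : H →ₐ[K] Module.End K W) : H ⊗[K] (H ⊗[K] H) →ₐ[K] Module.End K (U ⊗[K] (V ⊗[K] W)) :=
  (Module.endTensorEndAlgHom (R := K) (S := K) (A := K)).comp
    (Algebra.TensorProduct.map τ (act₂ ρ σ))

theorem assoc_aux₁ [Algebra K H] (τ : H →ₐ[K] Module.End K U) (ρ : H →ₐ[K] Module.End K V)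
    (σ : H →ₐ[K] Module.End K W) (h : H) (s : H ⊗[K] H) (x : U ⊗[K] V) (z : W) :
    TensorProduct.assoc K U V W (act₂ τ ρ s x ⊗ₜ σ h z) =
      act₃ τ ρ σ (TensorProduct.assoc K H H H (s ⊗ₜ h))
        (TensorProduct.assoc K U V W (x ⊗ₜ z)) := by
  induction s with
  | zero => simp
  | add s s' hs hs' => simp only [map_add, LinearMap.add_apply, TensorProduct.add_tmul, hs, hs']
  | tmul g g' =>
    induction x with
    | zero => simp
    | add t t' ht ht' => simp only [map_add, TensorProduct.add_tmul, ht, ht']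
    | tmul x y => rfl

theorem assoc_aux₂ [Bialgebra K H] (τ : H →ₐ[K] Module.End K U) (ρ : H →ₐ[K] Module.End K V)
    (σ : H →ₐ[K] Module.End K W) (s : H ⊗[K] H) (t : (U ⊗[K] V) ⊗[K] W) :
    TensorProduct.assoc K U V W (act₂ (tensorRep τ ρ) σ s t) =
      act₃ τ ρ σ (TensorProduct.assoc K H H H
        ((Coalgebra.comul (R := K) (A := H)).rTensor H s)) (TensorProduct.assoc K U V W t) := by
  induction s with
  | zero => simp
  | add s s' hs hs' => simp only [map_add, LinearMap.add_apply, hs, hs']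
  | tmul g h =>
    induction t with
    | zero => simp
    | add t t' ht ht' => simp only [map_add, ht, ht']
    | tmul x z => exact assoc_aux₁ τ ρ σ h (Coalgebra.comul g) x z

theorem assoc_aux₃ [Bialgebra K H] (τ : H →ₐ[K] Module.End K U) (ρ : H →ₐ[K] Module.End K V)
    (σ : H →ₐ[K] Module.End K W) (s : H ⊗[K] H) (t : U ⊗[K] (V ⊗[K] W)) :
    act₂ τ (tensorRep ρ σ) s t =
      act₃ τ ρ σ ((Coalgebra.comul (R := K) (A := H)).lTensor H s) t := by
  induction s with
  | zero => simp
  | add s s' hs hs' => simp only [map_add, LinearMap.add_apply, hs, hs']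
  | tmul g h =>
    induction t with
    | zero => simp
    | add t t' ht ht' => simp only [map_add, ht, ht']
    | tmul x z => rfl

theorem tensorRep_assoc [Bialgebra K H] (τ : H →ₐ[K] Module.End K U) (ρ : H →ₐ[K] Module.End K V)
    (σ : H →ₐ[K] Module.End K W) (h : H) (t : (U ⊗[K] V) ⊗[K] W) :
    TensorProduct.assoc K U V W (tensorRep (tensorRep τ ρ) σ h t) =
      tensorRep τ (tensorRep ρ σ) h (TensorProduct.assoc K U V W t) := by
  rw [tensorRep_apply, assoc_aux₂, Coalgebra.coassoc_apply, tensorRep_apply τ, assoc_aux₃]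

variable (K H) in
/-- The action of `H` on `K` through the counit. -/
def counitRep [Bialgebra K H] : H →ₐ[K] Module.End K K :=
  (Algebra.lsmul K K K).comp (Bialgebra.counitAlgHom K H)

theorem lid_aux [Bialgebra K H] (ρ : H →ₐ[K] Module.End K V) (s : H ⊗[K] H) (t : K ⊗[K] V) :
    TensorProduct.lid K V (act₂ (counitRep K H) ρ s t) =
      ρ (TensorProduct.lid K H ((Coalgebra.counit (R := K) (A := H)).rTensor H s))
        (TensorProduct.lid K V t) := by
  induction s with
  | zero => simp
  | add s s' hs hs' => simp only [map_add, LinearMap.add_apply, hs, hs']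
  | tmul g h =>
    induction t with
    | zero => simp
    | add t t' ht ht' => simp only [map_add, ht, ht']
    | tmul x z => simp [act₂_tmul, counitRep, mul_smul, smul_comm x]

theorem tensorRep_lid [Bialgebra K H] (ρ : H →ₐ[K] Module.End K V) (h : H) (t : K ⊗[K] V) :
    TensorProduct.lid K V (tensorRep (counitRep K H) ρ h t) =
      ρ h (TensorProduct.lid K V t) := by
  rw [tensorRep_apply, lid_aux, Coalgebra.rTensor_counit_comul, TensorProduct.lid_tmul, one_smul]

theorem rid_aux [Bialgebra K H] (ρ : H →ₐ[K] Module.End K V) (s : H ⊗[K] H) (t : V ⊗[K] K) :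
    TensorProduct.rid K V (act₂ ρ (counitRep K H) s t) =
      ρ (TensorProduct.rid K H ((Coalgebra.counit (R := K) (A := H)).lTensor H s))
        (TensorProduct.rid K V t) := by
  induction s with
  | zero => simp
  | add s s' hs hs' => simp only [map_add, LinearMap.add_apply, hs, hs']
  | tmul h g =>
    induction t with
    | zero => simp
    | add t t' ht ht' => simp only [map_add, ht, ht']
    | tmul z x => simp [act₂_tmul, counitRep, mul_smul, smul_comm x]

theorem tensorRep_rid [Bialgebra K H] (ρ : H →ₐ[K] Module.End K V) (h : H) (t : V ⊗[K] K) :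
    TensorProduct.rid K V (tensorRep ρ (counitRep K H) h t) =
      ρ h (TensorProduct.rid K V t) := by
  rw [tensorRep_apply, rid_aux, Coalgebra.lTensor_counit_comul, TensorProduct.rid_tmul, one_smul]

theorem prodRight_aux [Algebra K H] (τ : H →ₐ[K] Module.End K U) (ρ : H →ₐ[K] Module.End K V)
    (σ : H →ₐ[K] Module.End K W) (θ : H →ₐ[K] Module.End K (V × W))
    (hθ : ∀ h x, θ h x = (ρ h x.1, σ h x.2)) (s : H ⊗[K] H) (t : U ⊗[K] (V × W)) :
    TensorProduct.prodRight K K U V W (act₂ τ θ s t) =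
      (act₂ τ ρ s (TensorProduct.prodRight K K U V W t).1,
        act₂ τ σ s (TensorProduct.prodRight K K U V W t).2) := by
  induction s with
  | zero => simp only [map_zero, LinearMap.zero_apply]; rfl
  | add s s' hs hs' => simp only [map_add, LinearMap.add_apply, hs, hs', Prod.mk_add_mk]
  | tmul g h =>
    induction t with
    | zero => simp only [map_zero, Prod.fst_zero, Prod.snd_zero]; rfl
    | add t t' ht ht' => simp only [map_add, ht, ht', Prod.fst_add, Prod.snd_add, Prod.mk_add_mk]
    | tmul x z => simp only [act₂_tmul, hθ, TensorProduct.prodRight_tmul]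

theorem prodLeft_aux [Algebra K H] (τ : H →ₐ[K] Module.End K U) (ρ : H →ₐ[K] Module.End K V)
    (σ : H →ₐ[K] Module.End K W) (θ : H →ₐ[K] Module.End K (V × W))
    (hθ : ∀ h x, θ h x = (ρ h x.1, σ h x.2)) (s : H ⊗[K] H) (t : (V × W) ⊗[K] U) :
    TensorProduct.prodLeft K K V W U (act₂ θ τ s t) =
      (act₂ ρ τ s (TensorProduct.prodLeft K K V W U t).1,
        act₂ σ τ s (TensorProduct.prodLeft K K V W U t).2) := by
  induction s with
  | zero => simp only [map_zero, LinearMap.zero_apply]; rfl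
  | add s s' hs hs' => simp only [map_add, LinearMap.add_apply, hs, hs', Prod.mk_add_mk]
  | tmul g h =>
    induction t with
    | zero => simp only [map_zero, Prod.fst_zero, Prod.snd_zero]; rfl
    | add t t' ht ht' => simp only [map_add, ht, ht', Prod.fst_add, Prod.snd_add, Prod.mk_add_mk]
    | tmul x z => rw [act₂_tmul, hθ]; rfl

end Actions

variable {K H : Type u} [Field K] [Ring H] [Bialgebra K H]

/-- The action of `H` on a module by `K`-linear endomorphisms. -/
def rep (M : FDModule K H) : H →ₐ[K] Module.End K M := Algebra.lsmul K K M

/-- The underlying space of the tensor product `M ⊗ N` over `K`. -/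
def TensorSpace (M N : FDModule K H) : Type u := M ⊗[K] N

instance (M N : FDModule K H) : AddCommGroup (TensorSpace M N) :=
  inferInstanceAs (AddCommGroup (M ⊗[K] N))

instance (M N : FDModule K H) : Module K (TensorSpace M N) :=
  inferInstanceAs (Module K (M ⊗[K] N))

instance (M N : FDModule K H) : Module.Finite K (TensorSpace M N) :=
  inferInstanceAs (Module.Finite K (M ⊗[K] N))

/-- `H` acts on `M ⊗ N` through the comultiplication. -/
instance (M N : FDModule K H) : Module H (TensorSpace M N) :=
  Module.compHom (M ⊗[K] N) (tensorRep M.rep N.rep).toRingHom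

theorem tensor_smul_def (M N : FDModule K H) (h : H) (t : TensorSpace M N) :
    h • t = tensorRep M.rep N.rep h t := rfl

instance (M N : FDModule K H) : IsScalarTower K H (TensorSpace M N) :=
  ⟨fun k h t => by rw [tensor_smul_def, tensor_smul_def, map_smul]; rfl⟩

/-- The tensor product of two modules. -/
def tensor (M N : FDModule K H) : FDModule K H := ⟨TensorSpace M N⟩

variable (K H) in
/-- The trivial module: `K` with `H` acting through the counit. -/
def trivial : FDModule K H := char (Bialgebra.counitAlgHom K H)

/-- A `K`-linear equivalence that respects the actions. -/
def mkIso {V W : Type u} [AddCommGroup V] [Module K V] [Module H V] [AddCommGroup W] [Module K W]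
    [Module H W] (e : V ≃ₗ[K] W) (h : ∀ (g : H) (x : V), e (g • x) = g • e x) : V ≃ₗ[H] W :=
  { e with map_smul' := h }

theorem tensor_congr {M M' N N' : FDModule K H} (e : M ≃ₗ[H] M') (f : N ≃ₗ[H] N') :
    Nonempty (tensor M N ≃ₗ[H] tensor M' N') :=
  ⟨mkIso (V := TensorSpace M N) (W := TensorSpace M' N')
    (TensorProduct.congr (e.restrictScalars K) (f.restrictScalars K) : M ⊗[K] N ≃ₗ[K] M' ⊗[K] N')
    fun _ t => act₂_congr (ρ := M.rep) (σ := N.rep) (ρ' := M'.rep) (σ' := N'.rep)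
      (e.restrictScalars K) (f.restrictScalars K) (fun h x => e.map_smul h x)
      (fun h x => f.map_smul h x) _ t⟩

theorem tensor_assoc (L M N : FDModule K H) :
    Nonempty (tensor (tensor L M) N ≃ₗ[H] tensor L (tensor M N)) :=
  ⟨mkIso (V := TensorSpace (tensor L M) N) (W := TensorSpace L (tensor M N))
    (TensorProduct.assoc K L M N : (L ⊗[K] M) ⊗[K] N ≃ₗ[K] L ⊗[K] (M ⊗[K] N))
    fun g t => tensorRep_assoc L.rep M.rep N.rep g t⟩

theorem trivial_tensor (M : FDModule K H) : Nonempty (tensor (trivial K H) M ≃ₗ[H] M) :=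
  ⟨mkIso (V := TensorSpace (trivial K H) M) (TensorProduct.lid K M : K ⊗[K] M ≃ₗ[K] M)
    fun g t => tensorRep_lid M.rep g t⟩

theorem tensor_trivial (M : FDModule K H) : Nonempty (tensor M (trivial K H) ≃ₗ[H] M) :=
  ⟨mkIso (V := TensorSpace M (trivial K H)) (TensorProduct.rid K M : M ⊗[K] K ≃ₗ[K] M)
    fun g t => tensorRep_rid M.rep g t⟩

theorem tensor_directSum (L M N : FDModule K H) :
    Nonempty (tensor L (directSum M N) ≃ₗ[H] directSum (tensor L M) (tensor L N)) :=
  ⟨mkIso (V := TensorSpace L (directSum M N)) (W := TensorSpace L M × TensorSpace L N)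
    (TensorProduct.prodRight K K L M N : L ⊗[K] (M × N) ≃ₗ[K] (L ⊗[K] M) × (L ⊗[K] N))
    fun _ t => prodRight_aux L.rep M.rep N.rep (directSum M N).rep (fun _ _ => rfl) _ t⟩

theorem directSum_tensor (L M N : FDModule K H) :
    Nonempty (tensor (directSum M N) L ≃ₗ[H] directSum (tensor M L) (tensor N L)) :=
  ⟨mkIso (V := TensorSpace (directSum M N) L) (W := TensorSpace M L × TensorSpace N L)
    (TensorProduct.prodLeft K K M N L : (M × N) ⊗[K] L ≃ₗ[K] (M ⊗[K] L) × (N ⊗[K] L))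
    fun _ t => prodLeft_aux L.rep M.rep N.rep (directSum M N).rep (fun _ _ => rfl) _ t⟩

end

end FDModule

/-! ## The Green ring and the projective class ring -/

/-- Isomorphism classes of finite-dimensional `H`-modules. -/
def IsoClass (K H : Type u) [Field K] [Ring H] [Algebra K H] : Type (u + 1) :=
  Quotient (FDModule.isoSetoid K H)

noncomputable section

namespace IsoClass

variable {K H : Type u} [Field K] [Ring H]

/-- The isomorphism class of a module. -/
def mk [Algebra K H] (M : FDModule K H) : IsoClass K H := Quotient.mk _ M

theorem sound [Algebra K H] {M N : FDModule K H} (h : Nonempty (M ≃ₗ[H] N)) : mk M = mk N :=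
  Quotient.sound h

/-- Isomorphism classes form a monoid under the tensor product. -/
instance [Bialgebra K H] : Monoid (IsoClass K H) where
  mul := Quotient.map₂ FDModule.tensor fun _ _ ⟨e⟩ _ _ ⟨f⟩ => FDModule.tensor_congr e f
  one := mk (FDModule.trivial K H)
  mul_assoc := by
    rintro ⟨L⟩ ⟨M⟩ ⟨N⟩
    exact sound (FDModule.tensor_assoc L M N)
  one_mul := by
    rintro ⟨M⟩
    exact sound (FDModule.trivial_tensor M)
  mul_one := by
    rintro ⟨M⟩
    exact sound (FDModule.tensor_trivial M)

theorem mk_mul_mk [Bialgebra K H] (M N : FDModule K H) : mk M * mk N = mk (M.tensor N) := rfl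

end IsoClass

namespace GreenRing

variable (K H : Type u) [Field K] [Ring H]

/-- The subgroup generated by the elements `[M ⊕ N] - [M] - [N]`. -/
def relSubgroup [Algebra K H] : AddSubgroup (FreeAbelianGroup (IsoClass K H)) :=
  AddSubgroup.closure {x | ∃ M N : FDModule K H, x = FreeAbelianGroup.of (IsoClass.mk (M.directSum N))
    - FreeAbelianGroup.of (IsoClass.mk M) - FreeAbelianGroup.of (IsoClass.mk N)}

variable {K H}

theorem mul_mem_left [Bialgebra K H] (x : FreeAbelianGroup (IsoClass K H))
    {y : FreeAbelianGroup (IsoClass K H)} (hy : y ∈ relSubgroup K H) : x * y ∈ relSubgroup K H := by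
  induction x using FreeAbelianGroup.induction_on with
  | zero => rw [zero_mul]; exact zero_mem _
  | neg x h => rw [neg_mul]; exact neg_mem h
  | add x x' h h' => rw [add_mul]; exact add_mem h h'
  | of x =>
    obtain ⟨L, rfl⟩ : ∃ L, x = IsoClass.mk L := ⟨x.out, (Quotient.out_eq x).symm⟩
    induction hy using AddSubgroup.closure_induction with
    | zero => rw [mul_zero]; exact zero_mem _
    | neg y _ h => rw [mul_neg]; exact neg_mem h
    | add y y' _ _ h h' => rw [mul_add]; exact add_mem h h'
    | mem y hy =>
      obtain ⟨M, N, rfl⟩ := hy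
      refine AddSubgroup.subset_closure ⟨L.tensor M, L.tensor N, ?_⟩
      rw [mul_sub, mul_sub, FreeAbelianGroup.of_mul_of, FreeAbelianGroup.of_mul_of,
        FreeAbelianGroup.of_mul_of, IsoClass.mk_mul_mk, IsoClass.mk_mul_mk, IsoClass.mk_mul_mk,
        IsoClass.sound (FDModule.tensor_directSum L M N)]

theorem mul_mem_right [Bialgebra K H] {x : FreeAbelianGroup (IsoClass K H)}
    (y : FreeAbelianGroup (IsoClass K H)) (hx : x ∈ relSubgroup K H) : x * y ∈ relSubgroup K H := by
  induction y using FreeAbelianGroup.induction_on with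
  | zero => rw [mul_zero]; exact zero_mem _
  | neg y h => rw [mul_neg]; exact neg_mem h
  | add y y' h h' => rw [mul_add]; exact add_mem h h'
  | of y =>
    obtain ⟨L, rfl⟩ : ∃ L, y = IsoClass.mk L := ⟨y.out, (Quotient.out_eq y).symm⟩
    induction hx using AddSubgroup.closure_induction with
    | zero => rw [zero_mul]; exact zero_mem _
    | neg y _ h => rw [neg_mul]; exact neg_mem h
    | add y y' _ _ h h' => rw [add_mul]; exact add_mem h h'
    | mem y hy =>
      obtain ⟨M, N, rfl⟩ := hy
      refine AddSubgroup.subset_closure ⟨M.tensor L, N.tensor L, ?_⟩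
      rw [sub_mul, sub_mul, FreeAbelianGroup.of_mul_of, FreeAbelianGroup.of_mul_of,
        FreeAbelianGroup.of_mul_of, IsoClass.mk_mul_mk, IsoClass.mk_mul_mk, IsoClass.mk_mul_mk,
        IsoClass.sound (FDModule.directSum_tensor L M N)]

variable (K H) in
/-- The subgroup `relSubgroup` is a two-sided ideal for the product `[M][N] = [M ⊗ N]`. -/
def relIdeal [Bialgebra K H] : TwoSidedIdeal (FreeAbelianGroup (IsoClass K H)) :=
  TwoSidedIdeal.mk' (relSubgroup K H) (zero_mem _) add_mem neg_mem (mul_mem_left _)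
    (mul_mem_right _)

end GreenRing

/-- The Green ring `r(H)`: the abelian group generated by the isomorphism classes of
finite-dimensional `H`-modules modulo `[M ⊕ N] = [M] + [N]`, with product `[M][N] = [M ⊗ N]`. -/
abbrev GreenRing (K H : Type u) [Field K] [Ring H] [Bialgebra K H] : Type (u + 1) :=
  (GreenRing.relIdeal K H).ringCon.Quotient

/-- The class `[M]` in the Green ring. -/
def GreenRing.cls {K H : Type u} [Field K] [Ring H] [Bialgebra K H] (M : FDModule K H) :
    GreenRing K H :=
  (GreenRing.relIdeal K H).ringCon.mk' (FreeAbelianGroup.of (IsoClass.mk M))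

/-- The projective class ring `r_p(H)`: the subring of the Green ring generated by the classes of
the projective modules and of the simple modules. -/
def projectiveClassRing (K H : Type u) [Field K] [Ring H] [Bialgebra K H] :
    Subring (GreenRing K H) :=
  Subring.closure {x | ∃ M : FDModule K H,
    (Module.Projective H M ∨ IsSimpleModule H M) ∧ x = GreenRing.cls M}

/-! ## The simple modules `S_{i,j}` and the polynomial presentation -/

theorem HnZero.relations_simple {K : Type u} [Field K] (n : ℕ) (q : K) [hn : Fact (2 < n)]
    [hq : Fact (IsPrimitiveRoot q n)] (i j : ZMod n) :
    HnZero.Relations n q (0 : K) (q ^ i.val) (q ^ j.val) 0 := by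
  refine HnZero.relations_scalar HnZero.ne_zero_of_fact ?_ ?_ <;>
    rw [pow_right_comm, hq.out.pow_eq_one, one_pow]

/-- The one-dimensional module `S_{i,j}`: `a` and `d` act as `0`, `b` as `q ^ i`, `c` as
`q ^ j`. -/
def HnZero.simple {K : Type u} [Field K] (n : ℕ) (q : K) [Fact (2 < n)]
    [Fact (IsPrimitiveRoot q n)] (i j : ZMod n) : FDModule K (HnZero n q) :=
  FDModule.char (HnZero.lift (HnZero.relations_simple n q i j))

open MvPolynomial in
/-- The ideal `(xⁿ - 1, yⁿ - 1, z² - n ∑ xⁱ z)` of `ℤ[x,y,z]`, with `x, y, z` the variables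
`0, 1, 2`. -/
def classIdeal (n : ℕ) : Ideal (MvPolynomial (Fin 3) ℤ) :=
  Ideal.span {X 0 ^ n - 1, X 1 ^ n - 1,
    X 2 ^ 2 - (n : MvPolynomial (Fin 3) ℤ) * ∑ i ∈ Finset.range n, X 0 ^ i * X 2}

end

/-! ## Classes in the Green ring -/

/-! Write `S_{i,j}` for the one-dimensional module of weight `(i,j)`, where `b` acts as `q ^ i` and
`c` as `q ^ j`. The elements `a` and `d` are nilpotent and commute with every generator up to a
scalar, so they act as zero on a simple module. Then `b` and `c` act as scalars, which are powers of
`q`, and the simple modules are exactly the `S_{i,j}`.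

Let `P_{i,j}` be the module generated by a vector `u` of weight `(i,j)` with no further relations.
It has basis `a ^ k d ^ l u` with `k, l < n`. It is realised by explicit operators on a grid, so a
basis of `H` itself is never needed. The weight idempotents make `P_{i,j}` a retract of `H`, hence
projective. The map onto `S_{i,j}` has superfluous kernel, because that kernel is spanned by the
monomials of positive degree. A projective module that maps onto `S_{i,j}` therefore splits off
`P_{i,j}`, and by induction on dimension every projective module is a direct sum of such modules.

Tensoring with one-dimensional modules adds weights, so with `x = [S_{1,1}]`, `y = [S_{0,1}]` and `z
= [P_{0,0}]` one gets `[S_{i,i+j}] = x ^ i y ^ j` and `[P_{i,i+j}] = x ^ i y ^ j z`. Hence `x, y, z`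
generate the projective class ring. For the square of `z`, the subspace `u ⊗ P` generates `P ⊗ P`,
where `P = P_{0,0}`, and the basis of `P` consists of weight vectors. As `a` raises both weights by
one and `d` lowers both by one, `P ⊗ P` is the sum of the modules `P_{k-l,k-l}` over `k, l < n`.
This gives `z ^ 2 = n ∑ x ^ i z` and explains why only `x` occurs (`cls_indProj_mul_indProj`,
`cls_indProj_sq`).

The relations reduce every polynomial to a combination of the `2 n ^ 2` monomials `x ^ i y ^ j` and
`x ^ i y ^ j z` (`span_classMonomial`). These are independent in the Green ring
(`cls_linear_independent`). Independence needs no Krull–Schmidt theorem: for a fixed `h` in `H`, the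
rank of `h` on a module is additive on direct sums, and suitable choices of `h` isolate each
coefficient. -/

namespace FDModule

noncomputable section

variable {K H : Type u} [Field K] [Ring H] [Algebra K H]

/-- The direct sum of a finite family of modules. -/
def pi {ι : Type} [Finite ι] (M : ι → FDModule K H) : FDModule K H := ⟨∀ i, M i⟩

/-- A submodule of a finite-dimensional module. -/
def ofSubmodule {M : FDModule K H} (N : Submodule H M) : FDModule K H :=
  { carrier := N
    finite := inferInstanceAs (Module.Finite K (N.restrictScalars K)) }

/-- The quotient of a finite-dimensional module by a submodule. -/
def quotient {M : FDModule K H} (N : Submodule H M) : FDModule K H :=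
  { carrier := M ⧸ N
    finite := Module.Finite.of_surjective (N.mkQ.restrictScalars K) N.mkQ_surjective }

/-- The underlying space of the module given by a representation. -/
def RepSpace {V : Type u} [AddCommGroup V] [Module K V] (_ρ : H →ₐ[K] Module.End K V) : Type u := V

section RepSpace

variable {V : Type u} [AddCommGroup V] [Module K V] (ρ : H →ₐ[K] Module.End K V)

instance : AddCommGroup (RepSpace ρ) := inferInstanceAs (AddCommGroup V)

instance : Module K (RepSpace ρ) := inferInstanceAs (Module K V)

instance [Module.Finite K V] : Module.Finite K (RepSpace ρ) := inferInstanceAs (Module.Finite K V)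

instance : Module H (RepSpace ρ) := Module.compHom V ρ.toRingHom

theorem rep_smul_def (h : H) (x : RepSpace ρ) : h • x = (ρ h (x : V) : V) := rfl

instance : IsScalarTower K H (RepSpace ρ) :=
  ⟨fun k h x => by rw [rep_smul_def, rep_smul_def, map_smul]; rfl⟩

/-- The module given by a representation on a finite-dimensional space. -/
def ofRep [Module.Finite K V] : FDModule K H := ⟨RepSpace ρ⟩

end RepSpace

/-- The rank of the action of `h` on a module. -/
def rankOf (h : H) (M : FDModule K H) : ℕ :=
  Module.finrank K (LinearMap.range (Algebra.lsmul K K M h))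

theorem rankOf_congr (h : H) {M N : FDModule K H} (e : M ≃ₗ[H] N) : rankOf h M = rankOf h N := by
  let e' : M ≃ₗ[K] N := e.restrictScalars K
  have : LinearMap.range (Algebra.lsmul K K N h) =
      (LinearMap.range (Algebra.lsmul K K M h)).map e'.toLinearMap := by
    rw [← LinearMap.range_comp]
    apply le_antisymm
    · rintro _ ⟨x, rfl⟩
      exact ⟨e.symm x, by simp [e']⟩
    · rintro _ ⟨x, rfl⟩
      exact ⟨e x, by simp [e']⟩
  rw [rankOf, rankOf, this]
  exact (LinearEquiv.finrank_map_eq e' _).symm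

theorem rankOf_directSum (h : H) (M N : FDModule K H) :
    rankOf h (M.directSum N) = rankOf h M + rankOf h N := by
  let f := Algebra.lsmul K K M h
  let g := Algebra.lsmul K K N h
  have e : Algebra.lsmul K K (M.directSum N) h = f.prodMap g := rfl
  -- Corestriction to the ranges keeps the kernel and makes the product map surjective, so comparing
  -- rank-nullity for the two maps gives the sum of the ranks.
  have h0 : LinearMap.ker (f.rangeRestrict.prodMap g.rangeRestrict) =
      LinearMap.ker (f.prodMap g) := by
    ext x
    simp
  have h1 := LinearMap.finrank_range_add_finrank_ker (f.rangeRestrict.prodMap g.rangeRestrict)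
  have h2 := LinearMap.finrank_range_add_finrank_ker (f.prodMap g)
  have h3 : LinearMap.range (f.rangeRestrict.prodMap g.rangeRestrict) = ⊤ :=
    LinearMap.range_eq_top.mpr (Function.Surjective.prodMap f.surjective_rangeRestrict
      g.surjective_rangeRestrict)
  rw [h0, h3, finrank_top, Module.finrank_prod] at h1
  rw [rankOf, e]
  exact Nat.add_right_cancel (h2.trans h1.symm)

/-- The range of `g` together with the superfluous kernel of `f` spans `P`: any `x` differs from
some `g y` by an element of that kernel. -/
theorem IsProjectiveCover.surjective_of_comp {P M : FDModule K H} {f : P →ₗ[H] M}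
    (hf : ∀ N : Submodule H P, N ⊔ LinearMap.ker f = ⊤ → N = ⊤) {L : Type u} [AddCommGroup L]
    [Module H L] (g : L →ₗ[H] P) (hg : Function.Surjective (f ∘ₗ g)) : Function.Surjective g := by
  refine LinearMap.range_eq_top.mp (hf _ (eq_top_iff.mpr fun x _ => ?_))
  obtain ⟨y, hy⟩ := hg (f x)
  rw [← add_sub_cancel (g y) x]
  refine Submodule.add_mem_sup ⟨y, rfl⟩ ?_
  rw [LinearMap.mem_ker, map_sub, ← hy, LinearMap.comp_apply, sub_self]

/-- Projective covers are unique up to isomorphism. -/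
theorem IsProjectiveCover.nonempty_equiv {P P' M : FDModule K H} (h : P.IsProjectiveCover M)
    (h' : P'.IsProjectiveCover M) : Nonempty (P ≃ₗ[H] P') := by
  obtain ⟨hP, f, hf, hfs⟩ := h
  obtain ⟨hP', f', hf', hfs'⟩ := h'
  obtain ⟨g, hg⟩ := Module.projective_lifting_property f f' hf
  have hgs := surjective_of_comp hfs g (by rwa [hg])
  -- The section `s` of `g` is injective. It satisfies `f' ∘ s = f ∘ g ∘ s = f`, so superfluousness
  -- of the kernel of `f'` makes it surjective as well.
  obtain ⟨s, hs⟩ := Module.projective_lifting_property g LinearMap.id hgs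
  have hss := surjective_of_comp hfs' s (by
    rwa [← hg, LinearMap.comp_assoc, hs, LinearMap.comp_id])
  exact ⟨LinearEquiv.ofBijective s
    ⟨Function.LeftInverse.injective fun x => LinearMap.congr_fun hs x, hss⟩⟩

/-- A module that maps onto a projective module splits as a direct sum. -/
theorem nonempty_equiv_directSum_ker {M P : FDModule K H} [Module.Projective H P] (g : M →ₗ[H] P)
    (hg : Function.Surjective g) :
    Nonempty (M ≃ₗ[H] (ofSubmodule (LinearMap.ker g)).directSum P) := by
  obtain ⟨s, hs⟩ := Module.projective_lifting_property g LinearMap.id hg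
  have hex : Function.Exact (LinearMap.ker g).subtype g := LinearMap.exact_subtype_ker_map g
  exact ⟨(hex.splitSurjectiveEquiv (Submodule.injective_subtype _) ⟨s, hs⟩).1⟩

end

end FDModule

/-! ### Arithmetic in the Green ring and additive invariants on it -/

namespace GreenRing

noncomputable section

variable {K H : Type u} [Field K] [Ring H] [Bialgebra K H]

theorem cls_congr {M N : FDModule K H} (e : M ≃ₗ[H] N) : cls M = cls N := by
  rw [cls, cls, IsoClass.sound ⟨e⟩]

theorem cls_mul (M N : FDModule K H) : cls M * cls N = cls (M.tensor N) := by
  rw [cls, cls, ← map_mul, FreeAbelianGroup.of_mul_of, IsoClass.mk_mul_mk, cls]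

theorem cls_trivial : cls (FDModule.trivial K H) = 1 := rfl

theorem mk_eq_zero_iff (x : FreeAbelianGroup (IsoClass K H)) :
    (relIdeal K H).ringCon.mk' x = 0 ↔ x ∈ relSubgroup K H := by
  rw [← map_zero (relIdeal K H).ringCon.mk']
  change ((x : (relIdeal K H).ringCon.Quotient) = ((0 : FreeAbelianGroup (IsoClass K H)) :
    (relIdeal K H).ringCon.Quotient)) ↔ _
  rw [RingCon.eq, ← TwoSidedIdeal.mem_iff]
  exact TwoSidedIdeal.mem_mk' _ _ _ _ _ _ _

theorem cls_directSum (M N : FDModule K H) : cls (M.directSum N) = cls M + cls N := by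
  rw [← sub_eq_zero, ← sub_sub]
  simp only [cls, ← map_sub]
  rw [mk_eq_zero_iff]
  exact AddSubgroup.subset_closure ⟨M, N, rfl⟩

/-- A zero module satisfies `M ⊕ M ≅ M`, so its class equals its own double. -/
theorem cls_of_subsingleton (M : FDModule K H) [Subsingleton M] : cls M = 0 := by
  have e : (M.directSum M) ≃ₗ[H] M :=
    { toFun := fun _ => 0, invFun := fun _ => 0, map_add' := by simp, map_smul' := by simp
      left_inv := fun x => Prod.ext (Subsingleton.elim _ _) (Subsingleton.elim _ _)
      right_inv := fun x => Subsingleton.elim _ _ }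
  have h := cls_congr e
  rw [cls_directSum] at h
  exact left_eq_add.mp h.symm

theorem cls_pi {ι : Type} [Fintype ι] : ∀ M : ι → FDModule K H,
    cls (FDModule.pi M) = ∑ i, cls (M i) := by
  refine Fintype.induction_empty_option
    (P := fun ι _ => ∀ M : ι → FDModule K H, cls (FDModule.pi M) = ∑ i, cls (M i)) ?_ ?_ ?_ ι
  · intro α β _ e ih M
    let _ := Fintype.ofEquiv β e.symm
    rw [← e.sum_comp, ← ih]
    exact cls_congr (LinearEquiv.piCongrLeft H (fun i => (M i : Type u)) e).symm
  · intro M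
    have : Subsingleton (FDModule.pi M) := inferInstanceAs (Subsingleton (∀ i, M i))
    rw [cls_of_subsingleton, Finset.univ_eq_empty, Finset.sum_empty]
  · intro α _ ih M
    rw [Fintype.sum_option, ← ih, ← cls_directSum]
    refine cls_congr (M := FDModule.pi M)
      (N := (M none).directSum (FDModule.pi fun i => M (some i))) ?_
    exact { (Equiv.piOptionEquivProd (β := fun i => (M i : Type u))) with
      map_add' := fun _ _ => rfl
      map_smul' := fun _ _ => rfl }

/-- Rank is invariant under isomorphism and additive on direct sums, so it factors through the
defining relations. These homomorphisms serve as the coordinate functions that prove linear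
independence. -/
theorem exists_rankHom (h : H) : ∃ r : GreenRing K H →+ ℤ,
    ∀ M : FDModule K H, r (cls M) = M.rankOf h := by
  let f : FreeAbelianGroup (IsoClass K H) →+ ℤ := FreeAbelianGroup.lift
    (Quotient.lift (fun M : FDModule K H => (M.rankOf h : ℤ)) fun _ _ ⟨e⟩ => by
      rw [FDModule.rankOf_congr h e])
  have hf : relSubgroup K H ≤ f.ker := by
    rw [relSubgroup, AddSubgroup.closure_le]
    rintro _ ⟨M, N, rfl⟩
    simp only [SetLike.mem_coe, AddMonoidHom.mem_ker, map_sub, f]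
    change (((M.directSum N).rankOf h : ℤ)) - M.rankOf h - N.rankOf h = 0
    rw [FDModule.rankOf_directSum]
    push_cast
    ring
  have hmk : ∀ x y, (relIdeal K H).ringCon x y → f x = f y := by
    intro x y hxy
    have h1 : (relIdeal K H).ringCon.mk' (x - y) = 0 := by
      rw [map_sub, sub_eq_zero]
      exact (RingCon.eq _).mpr hxy
    rw [mk_eq_zero_iff] at h1
    have := hf h1
    rwa [AddMonoidHom.mem_ker, map_sub, sub_eq_zero] at this
  refine ⟨⟨⟨Quotient.lift f hmk, map_zero f⟩, ?_⟩, fun M => ?_⟩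
  · rintro ⟨x⟩ ⟨y⟩
    exact map_add f x y
  · exact FreeAbelianGroup.lift_apply_of _ _

end

end GreenRing

namespace HnZero

noncomputable section

variable {K : Type u} [Field K] {n : ℕ} {q : K}

/-! ## Modules over `H_n(0,q)` in terms of the generators -/

section Generators

variable {M N : Type u} [AddCommGroup M] [Module K M] [Module (HnZero n q) M]
  [IsScalarTower K (HnZero n q) M] [AddCommGroup N] [Module K N] [Module (HnZero n q) N]
  [IsScalarTower K (HnZero n q) N]

theorem smul_comm_gen (h : HnZero n q) (r : K) (x : M) : h • r • x = r • h • x := by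
  rw [← algebraMap_smul (HnZero n q) r x, ← algebraMap_smul (HnZero n q) r (h • x), smul_smul,
    smul_smul, Algebra.commutes]

/-- A `K`-linear map that commutes with the generators is a homomorphism of modules. -/
def homOfGen (f : M →ₗ[K] N) (hf : ∀ g x, f (gen n q g • x) = gen n q g • f x) :
    M →ₗ[HnZero n q] N :=
  { f with
    map_smul' := fun h => by
      let B : Subalgebra K (HnZero n q) :=
        { carrier := {h | ∀ x, f (h • x) = h • f x}
          mul_mem' := fun {g h} hg hh x => by rw [mul_smul, hg, hh, mul_smul]
          add_mem' := fun {g h} hg hh x => by rw [add_smul, map_add, hg, hh, add_smul]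
          algebraMap_mem' := fun r x => by rw [algebraMap_smul, algebraMap_smul, map_smul] }
      exact ((eq_top_of_gen_mem B hf) ▸ Algebra.mem_top : h ∈ B) }

@[simp]
theorem homOfGen_apply (f : M →ₗ[K] N) (hf : ∀ g x, f (gen n q g • x) = gen n q g • f x) (x : M) :
    homOfGen f hf x = f x := rfl

/-- A subspace that is stable under the generators is a submodule. -/
def submoduleOfGen (W : Submodule K M) (hW : ∀ g, ∀ x ∈ W, gen n q g • x ∈ W) :
    Submodule (HnZero n q) M :=
  { W with
    smul_mem' := fun h => by
      let B : Subalgebra K (HnZero n q) :=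
        { carrier := {h | ∀ x ∈ W, h • x ∈ W}
          mul_mem' := fun {g h} hg hh x hx => by rw [mul_smul]; exact hg _ (hh _ hx)
          add_mem' := fun {g h} hg hh x hx => by
            rw [add_smul]; exact W.add_mem (hg _ hx) (hh _ hx)
          algebraMap_mem' := fun r x hx => by rw [algebraMap_smul]; exact W.smul_mem _ hx }
      exact fun {x} => ((eq_top_of_gen_mem B hW) ▸ Algebra.mem_top : h ∈ B) x }

variable (n q) in
/-- `u` is a weight vector of weight `(i, j)`: `b` acts on it as `q ^ i` and `c` as `q ^ j`. -/
structure IsWeight (i j : ℤ) (u : M) : Prop where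
  b : gen n q .b • u = q ^ i • u
  c : gen n q .c • u = q ^ j • u

end Generators

theorem zpow_eq_zpow_iff (hq : IsPrimitiveRoot q n) (hn : n ≠ 0) (i j : ℤ) :
    q ^ i = q ^ j ↔ (n : ℤ) ∣ i - j := by
  have h0 : q ≠ 0 := hq.ne_zero hn
  rw [← hq.zpow_eq_one_iff_dvd, zpow_sub₀ h0, div_eq_one_iff_eq (zpow_ne_zero _ h0)]

theorem zpow_pow_eq_one (hq : IsPrimitiveRoot q n) (i : ℤ) : (q ^ i) ^ n = 1 := by
  rw [← zpow_natCast, ← zpow_mul]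
  exact (hq.zpow_eq_one_iff_dvd _).mpr (dvd_mul_left _ _)

/-! ## Operators on a grid -/

variable (K n) in
/-- The space with basis `Fin n × Fin n`. -/
abbrev GridSpace : Type u := Fin n × Fin n → K

variable (K n) in
/-- The basis vectors of `GridSpace`, extended by zero. -/
def gridVec (k l : ℕ) : GridSpace K n :=
  if h : k < n ∧ l < n then Pi.single (⟨k, h.1⟩, ⟨l, h.2⟩) 1 else 0

theorem gridVec_fin (p : Fin n × Fin n) : gridVec K n p.1 p.2 = Pi.basisFun K _ p := by
  rw [gridVec, dif_pos ⟨p.1.2, p.2.2⟩, Pi.basisFun_apply]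

theorem gridVec_eq_zero {k l : ℕ} (h : ¬ (k < n ∧ l < n)) : gridVec K n k l = 0 := dif_neg h

/-- The linear map with prescribed values on the basis vectors. -/
def gridMap {V : Type u} [AddCommGroup V] [Module K V] (f : ℕ → ℕ → V) : GridSpace K n →ₗ[K] V :=
  (Pi.basisFun K (Fin n × Fin n)).constr K fun p => f p.1 p.2

/-- The vanishing condition on `f` matches the zero convention for `gridVec`, so formulas for the
operators hold for all natural `k, l` without boundary cases. -/
theorem gridMap_gridVec {V : Type u} [AddCommGroup V] [Module K V] {f : ℕ → ℕ → V}
    (hf : ∀ k l, ¬ (k < n ∧ l < n) → f k l = 0) (k l : ℕ) :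
    gridMap f (gridVec K n k l) = f k l := by
  by_cases h : k < n ∧ l < n
  · have := gridVec_fin (K := K) ((⟨k, h.1⟩, ⟨l, h.2⟩) : Fin n × Fin n)
    simp only at this
    rw [this, gridMap, Module.Basis.constr_basis]
  · rw [gridVec_eq_zero h, map_zero, hf k l h]

theorem grid_hom_ext {V : Type u} [AddCommGroup V] [Module K V] {f g : GridSpace K n →ₗ[K] V}
    (h : ∀ k l, f (gridVec K n k l) = g (gridVec K n k l)) : f = g :=
  (Pi.basisFun K (Fin n × Fin n)).ext fun p => by rw [← gridVec_fin, h]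

variable (K n) in
/-- The action of `a`. -/
def opA : Module.End K (GridSpace K n) := gridMap fun k l => gridVec K n (k + 1) l

variable (n q) in
/-- The action of `d`. -/
def opD : Module.End K (GridSpace K n) := gridMap fun k l => q ^ k • gridVec K n k (l + 1)

variable (n q) in
/-- The action of `b` or `c`. -/
def opB (i : ℤ) : Module.End K (GridSpace K n) :=
  gridMap fun k l => q ^ (i + k - l) • gridVec K n k l

theorem opA_vec (k l : ℕ) : opA K n (gridVec K n k l) = gridVec K n (k + 1) l :=
  gridMap_gridVec (fun _ _ h => gridVec_eq_zero (by omega)) k l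

/-- The basis vector at `(k, l)` stands for `a ^ k d ^ l u`; the factor `q ^ k` comes from moving
`d` past `a ^ k` by `da = qad`. -/
theorem opD_vec (k l : ℕ) : opD n q (gridVec K n k l) = q ^ k • gridVec K n k (l + 1) :=
  gridMap_gridVec (f := fun k l => q ^ k • gridVec K n k (l + 1))
    (fun _ _ h => by rw [gridVec_eq_zero (by omega), smul_zero]) k l

/-- The exponent reflects that `a` raises the weight by one (`ba = qab`) and `d` lowers it by one
(`db = qbd`); the relations for `c` have the same form. -/
theorem opB_vec (i : ℤ) (k l : ℕ) :
    opB n q i (gridVec K n k l) = q ^ (i + k - l) • gridVec K n k l :=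
  gridMap_gridVec (f := fun k l => q ^ (i + k - l) • gridVec K n k l)
    (fun _ _ h => by rw [gridVec_eq_zero (by omega), smul_zero]) k l

theorem opA_pow_vec (m k l : ℕ) : (opA K n ^ m) (gridVec K n k l) = gridVec K n (k + m) l := by
  induction m with
  | zero => simp
  | succ m ih => rw [pow_succ', Module.End.mul_apply, ih, opA_vec, add_assoc]

theorem opD_pow_vec (m k l : ℕ) :
    (opD n q ^ m) (gridVec K n k l) = q ^ (k * m) • gridVec K n k (l + m) := by
  induction m with
  | zero => simp
  | succ m ih =>
    rw [pow_succ', Module.End.mul_apply, ih, map_smul, opD_vec, smul_smul, ← pow_add, add_assoc,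
      mul_add_one]

theorem opB_pow_vec (i : ℤ) (m k l : ℕ) :
    (opB n q i ^ m) (gridVec K n k l) = (q ^ (i + k - l)) ^ m • gridVec K n k l := by
  induction m with
  | zero => simp
  | succ m ih =>
    rw [pow_succ', Module.End.mul_apply, ih, map_smul, opB_vec, smul_smul, ← pow_succ]

theorem d_mul_a_pow (k : ℕ) :
    gen n q .d * gen n q .a ^ k = q ^ k • (gen n q .a ^ k * gen n q .d) :=
  QBinomial.mul_pow_skew (relations n q).da k

variable [hn : Fact (2 < n)] [hq : Fact (IsPrimitiveRoot q n)]

/-! ## The one-dimensional modules -/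

variable (n q) in
/-- The character of weight `(i, j)`. -/
def character (i j : ℤ) : HnZero n q →ₐ[K] K :=
  lift (relations_scalar ne_zero_of_fact (zpow_pow_eq_one hq.out i) (zpow_pow_eq_one hq.out j))

variable (n q) in
/-- The one-dimensional module of weight `(i, j)`. -/
def oneDim (i j : ℤ) : FDModule K (HnZero n q) := FDModule.char (character n q i j)

variable (n q) in
/-- The underlying space of `oneDim`. -/
def oneEquiv (i j : ℤ) : K ≃ₗ[K] oneDim n q i j := LinearEquiv.refl K K

variable (n q) in
/-- The basis vector of `oneDim`. -/
def oneVec (i j : ℤ) : oneDim n q i j := oneEquiv n q i j 1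

theorem smul_oneVec (i j : ℤ) (h : HnZero n q) :
    h • oneVec n q i j = character n q i j h • oneVec n q i j := rfl

theorem oneDim_eq_smul (i j : ℤ) (x : oneDim n q i j) : ∃ r : K, x = r • oneVec n q i j :=
  ⟨(oneEquiv n q i j).symm x, by
    rw [oneVec, ← map_smul, smul_eq_mul, mul_one, LinearEquiv.apply_symm_apply]⟩

theorem a_smul_oneDim (i j : ℤ) (x : oneDim n q i j) : gen n q .a • x = 0 := by
  obtain ⟨r, rfl⟩ := oneDim_eq_smul i j x
  rw [smul_comm_gen, smul_oneVec, character, lift_gen, genMap, zero_smul, smul_zero]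

theorem d_smul_oneDim (i j : ℤ) (x : oneDim n q i j) : gen n q .d • x = 0 := by
  obtain ⟨r, rfl⟩ := oneDim_eq_smul i j x
  rw [smul_comm_gen, smul_oneVec, character, lift_gen, genMap, zero_smul, smul_zero]

theorem isWeight_oneVec (i j : ℤ) : IsWeight n q i j (oneVec n q i j) :=
  ⟨by rw [smul_oneVec, character, lift_gen, genMap],
    by rw [smul_oneVec, character, lift_gen, genMap]⟩

theorem finrank_oneDim (i j : ℤ) : Module.finrank K (oneDim n q i j) = 1 :=
  Module.finrank_self K

theorem oneVec_ne_zero (i j : ℤ) : oneVec n q i j ≠ 0 :=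
  (oneEquiv n q i j).map_ne_zero_iff.mpr one_ne_zero

/-- Integer weights allow free addition and subtraction. Only their residues modulo `n` matter,
because the character sees just the powers of `q`; equal characters give equal modules, not merely
isomorphic ones. -/
theorem oneDim_congr {i j i' j' : ℤ} (hi : (n : ℤ) ∣ i - i') (hj : (n : ℤ) ∣ j - j') :
    oneDim n q i j = oneDim n q i' j' := by
  have : character n q i j = character n q i' j' := hom_ext fun g => by
    cases g <;> simp only [character, lift_gen, genMap]
    · exact (zpow_eq_zpow_iff hq.out ne_zero_of_fact _ _).mpr hi
    · exact (zpow_eq_zpow_iff hq.out ne_zero_of_fact _ _).mpr hj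
  rw [oneDim, oneDim, this]

theorem simple_eq_oneDim (i j : ZMod n) : simple n q i j = oneDim n q i.val j.val := by
  have : lift (relations_simple n q i j) = character n q i.val j.val := hom_ext fun g => by
    cases g <;> simp only [character, lift_gen, genMap, zpow_natCast]
  rw [simple, oneDim, this]

theorem trivial_eq_oneDim : FDModule.trivial K (HnZero n q) = oneDim n q 0 0 := by
  have : Bialgebra.counitAlgHom K (HnZero n q) = character n q 0 0 := hom_ext fun g => by
    rw [character, lift_gen, zpow_zero]
    exact counit_gen g
  rw [FDModule.trivial, oneDim, this]

section Hom

variable {M : Type u} [AddCommGroup M] [Module K M] [Module (HnZero n q) M]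
  [IsScalarTower K (HnZero n q) M]

/-- The homomorphism from a one-dimensional module given by a weight vector that `a` and `d`
annihilate. -/
def oneDimHom {i j : ℤ} {u : M} (hu : IsWeight n q i j u) (ha : gen n q .a • u = 0)
    (hd : gen n q .d • u = 0) : oneDim n q i j →ₗ[HnZero n q] M :=
  homOfGen (LinearMap.toSpanSingleton K M u ∘ₗ (oneEquiv n q i j).symm.toLinearMap) (by
    intro g x
    obtain ⟨r, rfl⟩ := oneDim_eq_smul i j x
    have h (r : K) : (LinearMap.toSpanSingleton K M u ∘ₗ (oneEquiv n q i j).symm.toLinearMap)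
        (r • oneVec n q i j) = r • u := by simp [oneVec]
    rw [smul_comm_gen, smul_oneVec, smul_smul, h, h, smul_comm_gen, mul_smul]
    congr 1
    cases g <;> simp only [character, lift_gen, genMap, ha, hd, hu.b, hu.c, zero_smul])

@[simp]
theorem oneDimHom_oneVec {i j : ℤ} {u : M} (hu : IsWeight n q i j u) (ha : gen n q .a • u = 0)
    (hd : gen n q .d • u = 0) : oneDimHom hu ha hd (oneVec n q i j) = u := by
  simp [oneDimHom, oneVec]

end Hom

/-! ## The indecomposable projective modules -/

variable (n q) in
-- This replaces a basis theorem for `H`: that the monomials `a ^ k d ^ l u` are independent is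
-- built into the model, and only the relations have to be checked.
theorem relations_grid (i j : ℤ) :
    Relations n q (opA K n) (opB n q i) (opB n q j) (opD n q) := by
  have q0 : q ≠ 0 := hq.out.ne_zero ne_zero_of_fact
  -- The goals that survive are `ba`, `db`, `ca`, `dc`, `bc`, `an`, `dn`, `da`, in this order. The
  -- relations `bn` and `cn` hold because each eigenvalue is a power of `q`.
  constructor <;> refine grid_hom_ext fun k l => ?_ <;>
    simp only [Module.End.mul_apply, LinearMap.smul_apply, opA_vec, opB_vec, opD_vec, map_smul,
      opA_pow_vec, opB_pow_vec, opD_pow_vec, smul_smul, LinearMap.zero_apply, Module.End.one_apply,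
      zpow_pow_eq_one hq.out, one_smul]
  · congr 1
    rw [mul_comm, ← zpow_add_one₀ q0]
    congr 1
    push_cast
    ring
  · congr 1
    rw [mul_comm q, mul_assoc, ← zpow_add_one₀ q0, mul_comm]
    congr 2
    push_cast
    ring
  · congr 1
    rw [mul_comm, ← zpow_add_one₀ q0]
    congr 1
    push_cast
    ring
  · congr 1
    rw [mul_comm q, mul_assoc, ← zpow_add_one₀ q0, mul_comm]
    congr 2
    push_cast
    ring
  · rw [mul_comm]
  · exact gridVec_eq_zero (by omega)
  · rw [gridVec_eq_zero (by omega), smul_zero]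
  · rw [pow_succ']

variable (n q) in
/-- The module generated by a vector of weight `(i, j)` subject to no further relations. -/
def indProj (i j : ℤ) : FDModule K (HnZero n q) := FDModule.ofRep (lift (relations_grid n q i j))

variable (n q) in
/-- The underlying space of `indProj`. -/
def gridEquiv (i j : ℤ) : GridSpace K n ≃ₗ[K] indProj n q i j := LinearEquiv.refl K _

variable (n q) in
/-- The basis vectors of `indProj`. -/
def vec (i j : ℤ) (k l : ℕ) : indProj n q i j := gridEquiv n q i j (gridVec K n k l)

section Vec

variable (i j : ℤ) (k l : ℕ)

theorem gen_smul_gridEquiv (g : Gen) (x : GridSpace K n) : gen n q g • gridEquiv n q i j x =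
    gridEquiv n q i j (genMap (opA K n) (opB n q i) (opB n q j) (opD n q) g x) := by
  rw [← lift_gen (relations_grid n q i j)]; rfl

theorem a_smul_vec : gen n q .a • vec n q i j k l = vec n q i j (k + 1) l := by
  rw [vec, gen_smul_gridEquiv, genMap, opA_vec, vec]

theorem d_smul_vec : gen n q .d • vec n q i j k l = q ^ k • vec n q i j k (l + 1) := by
  rw [vec, gen_smul_gridEquiv, genMap, opD_vec, map_smul, vec]

theorem b_smul_vec : gen n q .b • vec n q i j k l = q ^ (i + k - l) • vec n q i j k l := by
  rw [vec, gen_smul_gridEquiv, genMap, opB_vec, map_smul]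

theorem c_smul_vec : gen n q .c • vec n q i j k l = q ^ (j + k - l) • vec n q i j k l := by
  rw [vec, gen_smul_gridEquiv, genMap, opB_vec, map_smul]

theorem isWeight_vec : IsWeight n q (i + k - l) (j + k - l) (vec n q i j k l) :=
  ⟨b_smul_vec i j k l, c_smul_vec i j k l⟩

theorem a_pow_smul_vec (m : ℕ) : gen n q .a ^ m • vec n q i j k l = vec n q i j (k + m) l := by
  induction m with
  | zero => simp
  | succ m ih => rw [pow_succ', mul_smul, ih, a_smul_vec, add_assoc]

theorem d_pow_smul_vec (m : ℕ) :
    gen n q .d ^ m • vec n q i j k l = q ^ (k * m) • vec n q i j k (l + m) := by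
  induction m with
  | zero => simp
  | succ m ih =>
    rw [pow_succ', mul_smul, ih, smul_comm_gen, d_smul_vec, smul_smul, ← pow_add, add_assoc,
      mul_add_one]

theorem vec_eq_zero {k l : ℕ} (h : ¬ (k < n ∧ l < n)) : vec n q i j k l = 0 := by
  rw [vec, gridVec_eq_zero h, map_zero]

/-- The vector at `(0, 0)` generates the module, so homomorphisms and submodules are controlled by
it. -/
theorem vec_zero_zero : vec n q i j k l =
    gen n q .a ^ k • gen n q .d ^ l • vec n q i j 0 0 := by
  rw [d_pow_smul_vec, zero_mul, pow_zero, one_smul, a_pow_smul_vec, zero_add, zero_add]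

theorem eq_sum_vec (x : indProj n q i j) : ∃ r : Fin n × Fin n → K,
    x = ∑ p, r p • vec n q i j p.1 p.2 := by
  obtain ⟨y, rfl⟩ := (gridEquiv n q i j).surjective x
  refine ⟨y, ?_⟩
  have h := (Pi.basisFun K (Fin n × Fin n)).sum_repr y
  simp_rw [← gridVec_fin, Pi.basisFun_repr] at h
  simp_rw [vec, ← map_smul, ← map_sum, h]

theorem finrank_indProj : Module.finrank K (indProj n q i j) = n * n := by
  simp [← (gridEquiv n q i j).finrank_eq, Module.finrank_fintype_fun_eq_card]

end Vec

theorem eq_top_of_vec_mem {i j : ℤ} (N : Submodule (HnZero n q) (indProj n q i j))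
    (h : ∀ k l, vec n q i j k l ∈ N) : N = ⊤ := by
  refine eq_top_iff.mpr fun x _ => ?_
  obtain ⟨r, rfl⟩ := eq_sum_vec i j x
  exact N.sum_mem fun p _ => N.smul_of_tower_mem _ (h _ _)

section Hom

variable {M : Type u} [AddCommGroup M] [Module K M] [Module (HnZero n q) M]
  {i j : ℤ} {u : M}

variable (n q i j u) in
/-- The linear map underlying `indProjHom`. -/
def indProjMap : indProj n q i j →ₗ[K] M :=
  gridMap (fun k l => gen n q .a ^ k • gen n q .d ^ l • u) ∘ₗ (gridEquiv n q i j).symm.toLinearMap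

theorem indProjMap_vec (k l : ℕ) :
    indProjMap n q i j u (vec n q i j k l) = gen n q .a ^ k • gen n q .d ^ l • u := by
  rw [indProjMap, LinearMap.comp_apply, vec, LinearEquiv.coe_coe, LinearEquiv.symm_apply_apply]
  -- Off the grid the prescribed value vanishes because `a ^ n = d ^ n = 0`.
  refine gridMap_gridVec (f := fun k l => gen n q .a ^ k • gen n q .d ^ l • u) (fun k l h => ?_) k l
  by_cases hk : k < n
  · rw [pow_eq_zero_of_le (by omega : n ≤ l) (relations n q).dn, zero_smul, smul_zero]
  · rw [pow_eq_zero_of_le (by omega : n ≤ k) (relations n q).an, zero_smul]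

variable [IsScalarTower K (HnZero n q) M]

/-- `b` and `c` act on `a ^ k • d ^ l • u` by scalars. -/
theorem group_smul_monomial {g : HnZero n q} (hga : g * gen n q .a = q • (gen n q .a * g))
    (hdg : gen n q .d * g = q • (g * gen n q .d)) {m : ℤ} (hu : g • u = q ^ m • u) (k l : ℕ) :
    g • gen n q .a ^ k • gen n q .d ^ l • u =
      q ^ (m + k - l) • gen n q .a ^ k • gen n q .d ^ l • u := by
  have q0 : q ≠ 0 := hq.out.ne_zero ne_zero_of_fact
  have h1 : ∀ l : ℕ, g • gen n q .d ^ l • u = q ^ (m - l) • gen n q .d ^ l • u := by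
    intro l
    induction l with
    | zero => simpa using hu
    | succ l ih =>
      have h2 : g * gen n q .d = q⁻¹ • (gen n q .d * g) := by
        rw [hdg, smul_smul, inv_mul_cancel₀ q0, one_smul]
      rw [pow_succ', mul_smul, ← mul_smul g, h2, smul_assoc, mul_smul, ih, smul_comm_gen,
        smul_smul, mul_comm, ← zpow_sub_one₀ q0]
      congr 2
      push_cast
      ring
  rw [← mul_smul, QBinomial.mul_pow_skew hga, smul_assoc, mul_smul, h1, smul_comm_gen, smul_smul]
  congr 1
  rw [← zpow_natCast, ← zpow_add₀ q0]
  congr 1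
  ring

/-- The homomorphism from `indProj n q i j` given by a weight vector. -/
def indProjHom (hu : IsWeight n q i j u) : indProj n q i j →ₗ[HnZero n q] M :=
  homOfGen (indProjMap n q i j u) (by
    intro g x
    have key : ∀ k l : ℕ, indProjMap n q i j u (gen n q g • vec n q i j k l) =
        gen n q g • gen n q .a ^ k • gen n q .d ^ l • u := by
      intro k l
      cases g
      · rw [a_smul_vec, indProjMap_vec, pow_succ', mul_smul]
      · rw [b_smul_vec, map_smul, indProjMap_vec,
          group_smul_monomial (relations n q).ba (relations n q).db hu.b]
      · rw [c_smul_vec, map_smul, indProjMap_vec,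
          group_smul_monomial (relations n q).ca (relations n q).dc hu.c]
      · rw [d_smul_vec, map_smul, indProjMap_vec, ← mul_smul (gen n q .d), d_mul_a_pow, smul_assoc,
          mul_smul, pow_succ' _ l, mul_smul]
    obtain ⟨r, rfl⟩ := eq_sum_vec i j x
    rw [Finset.smul_sum, map_sum, map_sum, Finset.smul_sum]
    refine Finset.sum_congr rfl fun p _ => ?_
    rw [smul_comm_gen, map_smul, key, map_smul, indProjMap_vec, smul_comm_gen])

theorem indProjHom_vec (hu : IsWeight n q i j u) (k l : ℕ) :
    indProjHom hu (vec n q i j k l) = gen n q .a ^ k • gen n q .d ^ l • u :=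
  indProjMap_vec k l

theorem indProjHom_vec_zero (hu : IsWeight n q i j u) : indProjHom hu (vec n q i j 0 0) = u := by
  rw [indProjHom_vec, pow_zero, pow_zero, one_smul, one_smul]

end Hom

end

end HnZero

namespace HnZero

noncomputable section

variable {K : Type u} [Field K] {n : ℕ} {q : K}

/-! ## Weight idempotents -/

variable (n q) in
/-- The projector to the eigenspace of `g` for the eigenvalue `q ^ i`, when `g ^ n = 1`. -/
def projector (g : HnZero n q) (i : ℤ) : HnZero n q :=
  (n : K)⁻¹ • ∑ m ∈ Finset.range n, (q ^ (-i) • g) ^ m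

theorem commute_projector {g h : HnZero n q} (i : ℤ) (hgh : Commute h g) :
    Commute h (projector n q g i) :=
  (Commute.sum_right _ _ _ fun _ _ => (hgh.smul_right _).pow_right _).smul_right _

/-- With `t = q ^ (-i) g` one has `(t - 1) ∑ t ^ m = t ^ n - 1 = 0`, so `t` fixes the geometric sum.
-/
theorem mul_projector (hq : IsPrimitiveRoot q n) (hn : n ≠ 0) {g : HnZero n q} (hg : g ^ n = 1)
    (i : ℤ) : g * projector n q g i = q ^ i • projector n q g i := by
  have q0 : q ≠ 0 := hq.ne_zero hn
  have h := mul_geom_sum (q ^ (-i) • g) n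
  rw [smul_pow, zpow_pow_eq_one hq, hg, one_smul, sub_self, sub_mul, one_mul, sub_eq_zero] at h
  rw [projector, mul_smul_comm, smul_comm (q ^ i)]
  congr 1
  conv_rhs => rw [← h]
  rw [smul_mul_assoc, smul_smul, ← zpow_add₀ q0, add_neg_cancel, zpow_zero, one_smul]

/-- On an eigenvector the projector is the average of the powers of the `n`-th root of unity `q ^ (k
- i)`, which is `1` or `0` according to whether that root is trivial. -/
theorem projector_smul (hq : IsPrimitiveRoot q n) (hn : n ≠ 0) {M : Type u} [AddCommGroup M]
    [Module K M] [Module (HnZero n q) M] [IsScalarTower K (HnZero n q) M] {g : HnZero n q} {u : M}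
    {k : ℤ} (hu : g • u = q ^ k • u) (i : ℤ) :
    projector n q g i • u = if (n : ℤ) ∣ k - i then u else 0 := by
  have q0 : q ≠ 0 := hq.ne_zero hn
  have : NeZero n := ⟨hn⟩
  -- A primitive `n`-th root of unity exists only if the characteristic does not divide `n`.
  have n0 : (n : K) ≠ 0 := hq.neZero'.out
  have h1 (m : ℕ) : (q ^ (-i) • g) ^ m • u = (q ^ (k - i)) ^ m • u := by
    induction m with
    | zero => simp
    | succ m ih =>
      rw [pow_succ', mul_smul, ih, smul_comm_gen, smul_assoc, hu, smul_smul, smul_smul]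
      congr 1
      rw [mul_assoc, ← zpow_add₀ q0, pow_succ]
      congr 2
      ring
  rw [projector, smul_assoc, Finset.sum_smul, Finset.sum_congr rfl fun m _ => h1 m,
    ← Finset.sum_smul, smul_smul]
  split_ifs with h
  · rw [(hq.zpow_eq_one_iff_dvd _).mpr h]
    simp [n0]
  · have h2 : q ^ (k - i) - 1 ≠ 0 := sub_ne_zero.mpr fun h3 => h ((hq.zpow_eq_one_iff_dvd _).mp h3)
    have h3 := mul_geom_sum (q ^ (k - i)) n
    rw [zpow_pow_eq_one hq, sub_self] at h3
    rw [(mul_eq_zero.mp h3).resolve_left h2, mul_zero, zero_smul]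

variable (n q) in
/-- The projector to the space of weight `(i, j)`. -/
def weightProj (i j : ℤ) : HnZero n q :=
  projector n q (gen n q .b) i * projector n q (gen n q .c) j

/-- A nilpotent element that commutes with the generators up to scalars acts as zero on a simple
module. -/
theorem smul_eq_zero_of_isSimple {M : Type u} [AddCommGroup M] [Module K M] [Module (HnZero n q) M]
    [IsScalarTower K (HnZero n q) M] [IsSimpleModule (HnZero n q) M] {h : HnZero n q}
    (hh : h ^ n = 0) (hg : ∀ g, ∃ r : K, h * gen n q g = r • (gen n q g * h)) (x : M) :
    h • x = 0 := by
  let W : Submodule K M := LinearMap.ker (Algebra.lsmul K K M h)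
  have hW : ∀ x, x ∈ W ↔ h • x = 0 := fun x => Iff.rfl
  -- The kernel of `h` is stable because `h` commutes with each generator up to a scalar, so it is
  -- zero or everything. If it is zero, then `h` acts injectively, and `h ^ n = 0` forces `x = 0`.
  let N := submoduleOfGen W fun g x hx => by
    obtain ⟨r, hr⟩ := hg g
    rw [hW] at hx ⊢
    rw [← mul_smul, hr, smul_assoc, mul_smul, hx, smul_zero, smul_zero]
  rcases eq_bot_or_eq_top N with hN | hN
  · have hinj : ∀ y : M, h • y = 0 → y = 0 := fun y hy =>
      (Submodule.mem_bot _).mp (hN ▸ (show y ∈ N from hy))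
    have hpow : ∀ m, ∀ y : M, h ^ m • y = 0 → y = 0 := by
      intro m
      induction m with
      | zero => intro y hy; simpa using hy
      | succ m ih =>
        intro y hy
        rw [pow_succ', mul_smul] at hy
        exact ih y (hinj _ hy)
    rw [hpow n x (by rw [hh, zero_smul]), smul_zero]
  · exact (hN ▸ Submodule.mem_top : x ∈ N)

variable [hn : Fact (2 < n)] [hq : Fact (IsPrimitiveRoot q n)]

/-- The idempotent is a weight vector of the regular module, so it defines a homomorphism from
`indProj` to `H`. -/
theorem isWeight_weightProj (i j : ℤ) : IsWeight n q i j (weightProj n q i j) := by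
  constructor
  · rw [smul_eq_mul, weightProj, ← mul_assoc,
      mul_projector hq.out ne_zero_of_fact (relations n q).bn, smul_mul_assoc]
  · have h : Commute (gen n q .c) (gen n q .b) := (relations n q).bc.symm
    rw [smul_eq_mul, weightProj, ← mul_assoc, (commute_projector i h).eq, mul_assoc,
      mul_projector hq.out ne_zero_of_fact (relations n q).cn, mul_smul_comm]

theorem weightProj_smul {M : Type u} [AddCommGroup M] [Module K M] [Module (HnZero n q) M]
    [IsScalarTower K (HnZero n q) M] {u : M} {k l : ℤ} (hu : IsWeight n q k l u) (i j : ℤ) :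
    weightProj n q i j • u = if (n : ℤ) ∣ k - i ∧ (n : ℤ) ∣ l - j then u else 0 := by
  rw [weightProj, mul_smul, projector_smul hq.out ne_zero_of_fact hu.c]
  by_cases h : (n : ℤ) ∣ l - j
  · rw [if_pos h, projector_smul hq.out ne_zero_of_fact hu.b]
    simp [h]
  · simp [h]

/-! ## Projectivity and projective covers -/

theorem indProj_hom_ext {M : Type u} [AddCommGroup M] [Module (HnZero n q) M] {i j : ℤ}
    {f g : indProj n q i j →ₗ[HnZero n q] M} (h : f (vec n q i j 0 0) = g (vec n q i j 0 0)) :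
    f = g := by
  have : LinearMap.eqLocus f g = ⊤ := eq_top_of_vec_mem _ fun k l => by
    rw [LinearMap.mem_eqLocus, vec_zero_zero, map_smul, map_smul, map_smul, map_smul, h]
  exact LinearMap.ext fun x => (this ▸ Submodule.mem_top : x ∈ LinearMap.eqLocus f g)

/-- Sending the generator to the weight idempotent `e`, and then `1` back to the generator `u`,
gives `u ↦ e • u = u`. Thus `indProj` is a retract of the regular module. -/
instance projective_indProj (i j : ℤ) : Module.Projective (HnZero n q) (indProj n q i j) := by
  refine Module.Projective.of_split (indProjHom (isWeight_weightProj i j))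
    (LinearMap.toSpanSingleton (HnZero n q) _ (vec n q i j 0 0)) (indProj_hom_ext ?_)
  have h := isWeight_vec (n := n) (q := q) i j 0 0
  rw [LinearMap.comp_apply, indProjHom_vec_zero, LinearMap.toSpanSingleton_apply,
    weightProj_smul h]
  simp

variable (n q) in
/-- The canonical epimorphism from `indProj` to `oneDim`. -/
def coverMap (i j : ℤ) : indProj n q i j →ₗ[HnZero n q] oneDim n q i j :=
  indProjHom (isWeight_oneVec i j)

theorem coverMap_vec_zero (i j : ℤ) : coverMap n q i j (vec n q i j 0 0) = oneVec n q i j :=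
  indProjHom_vec_zero _

theorem coverMap_vec (i j : ℤ) {k l : ℕ} (h : (k, l) ≠ (0, 0)) :
    coverMap n q i j (vec n q i j k l) = 0 := by
  rw [coverMap, indProjHom_vec]
  rcases k with _ | k
  · rcases l with _ | l
    · exact absurd rfl h
    · rw [pow_succ' _ l, mul_smul, d_smul_oneDim, smul_zero]
  · rw [pow_succ', mul_smul, a_smul_oneDim]

theorem surjective_of_oneVec_mem_range {i j : ℤ} {M : Type u} [AddCommGroup M]
    [Module (HnZero n q) M] (f : M →ₗ[HnZero n q] oneDim n q i j)
    (h : oneVec n q i j ∈ LinearMap.range f) : Function.Surjective f := by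
  refine LinearMap.range_eq_top.mp (eq_top_iff.mpr fun x _ => ?_)
  obtain ⟨r, rfl⟩ := oneDim_eq_smul i j x
  exact (LinearMap.range f).smul_of_tower_mem r h

/-- A graded form of Nakayama's lemma: `N` contains a vector whose lowest term is the generator, and
applying monomials in `a` and `d` recovers all basis vectors from the top degree downwards. -/
theorem superfluous_ker_coverMap (i j : ℤ) (N : Submodule (HnZero n q) (indProj n q i j))
    (hN : N ⊔ LinearMap.ker (coverMap n q i j) = ⊤) : N = ⊤ := by
  obtain ⟨y, hy, z, hz, hyz⟩ := Submodule.mem_sup.mp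
    (hN ▸ Submodule.mem_top : vec n q i j 0 0 ∈ N ⊔ LinearMap.ker (coverMap n q i j))
  have hn0 : 0 < n := Nat.pos_of_ne_zero (ne_zero_of_fact (n := n))
  let o : Fin n × Fin n := (⟨0, hn0⟩, ⟨0, hn0⟩)
  obtain ⟨r, rfl⟩ := eq_sum_vec i j y
  have hne : ∀ p : Fin n × Fin n, p ≠ o → ((p.1 : ℕ), (p.2 : ℕ)) ≠ (0, 0) := by
    intro p hp h
    simp only [Prod.mk.injEq] at h
    exact hp (Prod.ext (Fin.ext h.1) (Fin.ext h.2))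
  -- The map `coverMap` kills `z` and every basis vector except the generator, so it reads off the
  -- coefficient of the generator in `y`.
  have hr : r o = 1 := by
    have h1 := congrArg (coverMap n q i j) hyz
    rw [map_add, LinearMap.mem_ker.mp hz, add_zero, coverMap_vec_zero, map_sum,
      Finset.sum_eq_single o (fun p _ hp => by
        rw [LinearMap.map_smul_of_tower, coverMap_vec i j (hne p hp), smul_zero])
        (fun h => absurd (Finset.mem_univ _) h), LinearMap.map_smul_of_tower] at h1
    have h2 : coverMap n q i j (vec n q i j o.1 o.2) = oneVec n q i j := coverMap_vec_zero i j
    rw [h2] at h1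
    exact smul_left_injective K (oneVec_ne_zero i j) (h1.trans (one_smul K _).symm)
  refine eq_top_of_vec_mem N fun k l => ?_
  -- Descending induction on the degree `k + l`, with `m` as fuel. From degree `2 * n` on, the
  -- vector lies off the grid and is zero. Below that, `a ^ k d ^ l y` is `vec k l` plus terms of
  -- higher degree.
  have key : ∀ m k l, 2 * n ≤ k + l + m → vec n q i j k l ∈ N := by
    intro m
    induction m with
    | zero =>
      intro k l h
      rw [vec_eq_zero i j (by omega)]
      exact N.zero_mem
    | succ m ih =>
      intro k l h
      have h1 := N.smul_mem (gen n q .a ^ k * gen n q .d ^ l) hy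
      rw [← Finset.add_sum_erase _ _ (Finset.mem_univ o), hr, one_smul, smul_add, mul_smul,
        Finset.smul_sum] at h1
      have h2 : vec n q i j k l = gen n q .a ^ k • gen n q .d ^ l • vec n q i j o.1 o.2 :=
        vec_zero_zero i j k l
      rw [h2]
      refine (N.add_mem_iff_left (N.sum_mem fun p hp => ?_)).mp h1
      have hp' := hne p (Finset.ne_of_mem_erase hp)
      rw [smul_comm_gen, mul_smul, d_pow_smul_vec, smul_comm_gen, a_pow_smul_vec]
      refine N.smul_of_tower_mem _ (N.smul_of_tower_mem _ (ih _ _ ?_))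
      have : 0 < (p.1 : ℕ) + p.2 := by
        by_contra h0
        exact hp' (Prod.ext (by simp only; omega) (by simp only; omega))
      omega
  exact key (2 * n) k l (by omega)

theorem surjective_coverMap (i j : ℤ) : Function.Surjective (coverMap n q i j) :=
  surjective_of_oneVec_mem_range _ ⟨_, coverMap_vec_zero i j⟩

theorem isProjectiveCover_indProj (i j : ℤ) :
    (indProj n q i j).IsProjectiveCover (oneDim n q i j) :=
  ⟨projective_indProj i j, coverMap n q i j, surjective_coverMap i j,
    superfluous_ker_coverMap i j⟩

/-! ## Simple modules -/

theorem isSimpleModule_oneDim (i j : ℤ) : IsSimpleModule (HnZero n q) (oneDim n q i j) := by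
  have : Nontrivial (oneDim n q i j) := ⟨⟨_, 0, oneVec_ne_zero i j⟩⟩
  rw [isSimpleModule_iff_toSpanSingleton_surjective]
  refine ⟨this, fun x hx => ?_⟩
  refine surjective_of_oneVec_mem_range _ ?_
  obtain ⟨r, rfl⟩ := oneDim_eq_smul i j x
  have hr : r ≠ 0 := by
    rintro rfl
    exact hx (zero_smul _ _)
  refine ⟨algebraMap K _ r⁻¹, ?_⟩
  rw [LinearMap.toSpanSingleton_apply, algebraMap_smul, smul_smul, inv_mul_cancel₀ hr, one_smul]

/-- This is Schur's lemma: an eigenspace of `h` is a nonzero submodule, and the eigenvalue is an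
`n`-th root of unity. Commutation is required only on `M`, since `b` and `c` do not commute with `a`
and `d` in `H`. -/
theorem exists_scalar_of_isSimple [IsAlgClosed K] {M : Type u} [AddCommGroup M] [Module K M]
    [Module.Finite K M] [Module (HnZero n q) M] [IsScalarTower K (HnZero n q) M]
    [IsSimpleModule (HnZero n q) M] {h : HnZero n q} (hh : h ^ n = 1)
    (hg : ∀ g, ∀ x : M, h • gen n q g • x = gen n q g • h • x) :
    ∃ i : ℤ, ∀ x : M, h • x = q ^ i • x := by
  have : Nontrivial M := IsSimpleModule.nontrivial (HnZero n q) M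
  obtain ⟨s, hs⟩ := Module.End.exists_eigenvalue (Algebra.lsmul K K M h)
  let W := Module.End.eigenspace (Algebra.lsmul K K M h) s
  have hW : ∀ x, x ∈ W ↔ h • x = s • x := fun x => Module.End.mem_eigenspace_iff
  let N := submoduleOfGen W fun g x hx => by
    rw [hW] at hx ⊢
    rw [hg, hx, smul_comm_gen]
  obtain ⟨v, hv, hv0⟩ := hs.exists_hasEigenvector
  have hN : N = ⊤ := (eq_bot_or_eq_top N).resolve_left fun hN =>
    hv0 ((Submodule.mem_bot _).mp (hN ▸ (show v ∈ N from hv)))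
  have hall : ∀ x : M, h • x = s • x := fun x => (hW x).mp (hN ▸ Submodule.mem_top : x ∈ N)
  have hsn : s ^ n = 1 := by
    have hpow : ∀ m : ℕ, h ^ m • v = s ^ m • v := by
      intro m
      induction m with
      | zero => simp
      | succ m ih => rw [pow_succ, mul_smul, hall, smul_comm_gen, ih, smul_smul, pow_succ']
    have h1 := hpow n
    rw [hh, one_smul] at h1
    exact (smul_left_injective K hv0 (by simpa using h1)).symm
  have : NeZero n := ⟨ne_zero_of_fact⟩
  obtain ⟨i, -, hi⟩ := hq.out.eq_pow_of_pow_eq_one hsn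
  exact ⟨i, fun x => by rw [hall, zpow_natCast, hi]⟩

/-- Every finite-dimensional simple module is one-dimensional. -/
theorem exists_equiv_oneDim [IsAlgClosed K] (M : FDModule K (HnZero n q))
    [IsSimpleModule (HnZero n q) M] :
    ∃ i j : ℤ, Nonempty (M ≃ₗ[HnZero n q] oneDim n q i j) := by
  have r := relations n q
  have q0 : q ≠ 0 := hq.out.ne_zero ne_zero_of_fact
  have inv : ∀ x y : HnZero n q, x * y = q • (y * x) → y * x = q⁻¹ • (x * y) := by
    intro x y h
    rw [h, smul_smul, inv_mul_cancel₀ q0, one_smul]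
  have ha : ∀ x : M, gen n q .a • x = 0 := smul_eq_zero_of_isSimple r.an fun g => by
    cases g
    · exact ⟨1, by simp⟩
    · exact ⟨q⁻¹, inv _ _ r.ba⟩
    · exact ⟨q⁻¹, inv _ _ r.ca⟩
    · exact ⟨q⁻¹, inv _ _ r.da⟩
  have hd : ∀ x : M, gen n q .d • x = 0 := smul_eq_zero_of_isSimple r.dn fun g => by
    cases g
    · exact ⟨q, r.da⟩
    · exact ⟨q, r.db⟩
    · exact ⟨q, r.dc⟩
    · exact ⟨1, by simp⟩
  -- Since `a` and `d` act as zero, `b` and `c` commute on `M` with all the generators.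
  obtain ⟨i, hi⟩ := exists_scalar_of_isSimple (M := M) r.bn fun g x => by
    cases g
    · rw [ha, ha, smul_zero]
    · rfl
    · rw [← mul_smul, r.bc, mul_smul]
    · rw [hd, hd, smul_zero]
  obtain ⟨j, hj⟩ := exists_scalar_of_isSimple (M := M) r.cn fun g x => by
    cases g
    · rw [ha, ha, smul_zero]
    · rw [← mul_smul, ← r.bc, mul_smul]
    · rfl
    · rw [hd, hd, smul_zero]
  have : Nontrivial M := IsSimpleModule.nontrivial (HnZero n q) M
  have := isSimpleModule_oneDim (n := n) (q := q) i j
  obtain ⟨u, hu⟩ := exists_ne (0 : M)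
  -- Any nonzero vector `u` now has weight `(i, j)` and is killed by `a` and `d`. The resulting map
  -- between simple modules is nonzero, hence bijective.
  let f := oneDimHom (i := i) (j := j) ⟨hi u, hj u⟩ (ha u) (hd u)
  refine ⟨i, j, ⟨(LinearEquiv.ofBijective f ((LinearMap.bijective_or_eq_zero f).resolve_right
    fun h => hu ?_)).symm⟩⟩
  rw [← oneDimHom_oneVec (i := i) (j := j) ⟨hi u, hj u⟩ (ha u) (hd u)]
  exact LinearMap.congr_fun h _

/-- Every nonzero finite-dimensional module has a one-dimensional quotient. -/
theorem exists_surjective_oneDim [IsAlgClosed K] (M : FDModule K (HnZero n q)) [Nontrivial M] :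
    ∃ i j : ℤ, ∃ f : M →ₗ[HnZero n q] oneDim n q i j, Function.Surjective f := by
  have : IsNoetherian (HnZero n q) M := isNoetherian_of_tower K inferInstance
  obtain ⟨N, hN, -⟩ := (eq_top_or_exists_le_coatom (⊥ : Submodule (HnZero n q) M)).resolve_left
    bot_ne_top
  have : IsSimpleModule (HnZero n q) (FDModule.quotient N) := isSimpleModule_iff_isCoatom.mpr hN
  obtain ⟨i, j, ⟨e⟩⟩ := exists_equiv_oneDim (FDModule.quotient N)
  exact ⟨i, j, e.toLinearMap ∘ₗ N.mkQ, e.surjective.comp N.mkQ_surjective⟩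

/-- The class of a projective module is a sum of classes of the modules `indProj`. -/
theorem cls_projective_mem [IsAlgClosed K] (R : AddSubgroup (GreenRing K (HnZero n q)))
    (hR : ∀ i j, GreenRing.cls (indProj n q i j) ∈ R) (M : FDModule K (HnZero n q))
    (hM : Module.Projective (HnZero n q) M) : GreenRing.cls M ∈ R := by
  induction hr : Module.finrank K M using Nat.strong_induction_on generalizing M with
  | _ r ih =>
    rcases subsingleton_or_nontrivial M with h | h
    · rw [GreenRing.cls_of_subsingleton]
      exact R.zero_mem
    · obtain ⟨i, j, f, hf⟩ := exists_surjective_oneDim M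
      -- Projectivity of `M` lifts `f` to the cover, and superfluousness makes the lift surjective.
      -- Projectivity of the cover then splits it off, leaving a kernel of smaller dimension.
      obtain ⟨g, hg⟩ := Module.projective_lifting_property (coverMap n q i j) f
        (surjective_coverMap i j)
      have hgs := FDModule.IsProjectiveCover.surjective_of_comp (superfluous_ker_coverMap i j) g
        (by rwa [hg])
      obtain ⟨e⟩ := FDModule.nonempty_equiv_directSum_ker g hgs
      have hfin : Module.finrank K M = Module.finrank K (FDModule.ofSubmodule (LinearMap.ker g)) +
          n * n := by
        rw [(e.restrictScalars K).finrank_eq, ← finrank_indProj (n := n) (q := q) i j]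
        exact Module.finrank_prod
      rw [GreenRing.cls_congr e, GreenRing.cls_directSum]
      refine R.add_mem (ih _ ?_ _ ?_ rfl) (hR i j)
      · have := hn.out
        nlinarith
      -- The kernel is a retract of `M`, hence projective, so the induction hypothesis applies to
      -- it.
      · refine Module.Projective.of_split (e.symm.toLinearMap ∘ₗ LinearMap.inl _ _ _)
          (LinearMap.fst _ _ _ ∘ₗ e.toLinearMap) (LinearMap.ext fun x => ?_)
        exact congrArg Prod.fst (e.apply_symm_apply (x, 0))

end

end HnZero

namespace HnZero

noncomputable section

variable {K : Type u} [Field K] {n : ℕ} {q : K} [hn : Fact (2 < n)]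
  [hq : Fact (IsPrimitiveRoot q n)]

/-! ## Tensor products -/

/-- The pure tensors in a tensor product of modules. -/
def pureTensor (M N : FDModule K (HnZero n q)) : M →ₗ[K] N →ₗ[K] M.tensor N :=
  TensorProduct.mk K M N

section PureTensor

variable {M N : FDModule K (HnZero n q)} (x : M) (y : N)

theorem a_smul_pureTensor : gen n q .a • pureTensor M N x y =
    pureTensor M N (gen n q .a • x) (gen n q .b • y) + pureTensor M N x (gen n q .a • y) := by
  have h : gen n q .a • pureTensor M N x y = FDModule.act₂ M.rep N.rep
      (Coalgebra.comul (R := K) (gen n q .a)) (x ⊗ₜ[K] y) := rfl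
  rw [h, comul_gen, genMap, map_add, LinearMap.add_apply, FDModule.act₂_tmul, FDModule.act₂_tmul,
    map_one]
  rfl

theorem d_smul_pureTensor : gen n q .d • pureTensor M N x y =
    pureTensor M N (gen n q .d • x) (gen n q .c • y) + pureTensor M N x (gen n q .d • y) := by
  have h : gen n q .d • pureTensor M N x y = FDModule.act₂ M.rep N.rep
      (Coalgebra.comul (R := K) (gen n q .d)) (x ⊗ₜ[K] y) := rfl
  rw [h, comul_gen, genMap, map_add, LinearMap.add_apply, FDModule.act₂_tmul, FDModule.act₂_tmul,
    map_one]
  rfl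

theorem b_smul_pureTensor : gen n q .b • pureTensor M N x y =
    pureTensor M N (gen n q .b • x) (gen n q .b • y) := by
  have h : gen n q .b • pureTensor M N x y = FDModule.act₂ M.rep N.rep
      (Coalgebra.comul (R := K) (gen n q .b)) (x ⊗ₜ[K] y) := rfl
  rw [h, comul_gen, genMap, FDModule.act₂_tmul]
  rfl

theorem c_smul_pureTensor : gen n q .c • pureTensor M N x y =
    pureTensor M N (gen n q .c • x) (gen n q .c • y) := by
  have h : gen n q .c • pureTensor M N x y = FDModule.act₂ M.rep N.rep
      (Coalgebra.comul (R := K) (gen n q .c)) (x ⊗ₜ[K] y) := rfl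
  rw [h, comul_gen, genMap, FDModule.act₂_tmul]
  rfl

theorem IsWeight.pureTensor {x : M} {y : N} {i j k l : ℤ} (hx : IsWeight n q i j x)
    (hy : IsWeight n q k l y) : IsWeight n q (i + k) (j + l) (pureTensor M N x y) := by
  have q0 : q ≠ 0 := hq.out.ne_zero ne_zero_of_fact
  constructor
  · rw [b_smul_pureTensor, hx.b, hy.b, map_smul, map_smul, LinearMap.smul_apply, smul_smul,
      zpow_add₀ q0, mul_comm]
  · rw [c_smul_pureTensor, hx.c, hy.c, map_smul, map_smul, LinearMap.smul_apply, smul_smul,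
      zpow_add₀ q0, mul_comm]

theorem eq_top_of_pureTensor_mem (W : Submodule (HnZero n q) (M.tensor N))
    (h : ∀ x y, pureTensor M N x y ∈ W) : W = ⊤ := by
  refine eq_top_iff.mpr fun t _ => ?_
  exact TensorProduct.induction_on (motive := fun t : M ⊗[K] N => (t : M.tensor N) ∈ W) t
    W.zero_mem h fun _ _ => W.add_mem

theorem finrank_tensor (M N : FDModule K (HnZero n q)) :
    Module.finrank K (M.tensor N) = Module.finrank K M * Module.finrank K N :=
  Module.finrank_tensorProduct (R := K) (S := K) (M := M) (M' := N)

end PureTensor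

/-- A surjective homomorphism between modules of the same dimension identifies their classes. -/
theorem cls_eq_of_surjective {M N : FDModule K (HnZero n q)} (f : M →ₗ[HnZero n q] N)
    (hf : Function.Surjective f) (h : Module.finrank K M = Module.finrank K N) :
    GreenRing.cls M = GreenRing.cls N :=
  GreenRing.cls_congr (LinearEquiv.ofBijective f
    ⟨(LinearMap.injective_iff_surjective_of_finrank_eq_finrank (f := f.restrictScalars K) h).mpr hf,
      hf⟩)

/-- In `a • (x ⊗ y) = ax ⊗ by + x ⊗ ay` the element `b` acts invertibly. Once `W` contains `x ⊗ y`
for every `y`, it therefore contains `ax ⊗ y` for every `y`, and likewise for `d` with `c`. Hence `u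
⊗ M` generates the tensor product when `u` is the generator of the first factor. -/
theorem eq_top_of_vec_pureTensor_mem {i j : ℤ} {M : FDModule K (HnZero n q)}
    (W : Submodule (HnZero n q) ((indProj n q i j).tensor M))
    (h : ∀ y, pureTensor _ M (vec n q i j 0 0) y ∈ W) : W = ⊤ := by
  have hn0 : n ≠ 0 := ne_zero_of_fact
  have hd : ∀ l y, pureTensor _ M (vec n q i j 0 l) y ∈ W := by
    intro l
    induction l with
    | zero => exact h
    | succ l ih =>
      intro y
      -- The power `c ^ (n - 1)` is the inverse of `c`, so the first term of the coproduct formula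
      -- becomes `du ⊗ y` with the given `y`.
      have h1 := W.smul_mem (gen n q .d) (ih (gen n q .c ^ (n - 1) • y))
      rw [d_smul_pureTensor, d_smul_vec, pow_zero, one_smul, ← mul_smul (gen n q .c),
        mul_pow_sub_one hn0, (relations n q).cn, one_smul] at h1
      exact (W.add_mem_iff_left (ih _)).mp h1
  have ha : ∀ k l y, pureTensor _ M (vec n q i j k l) y ∈ W := by
    intro k l
    induction k with
    | zero => exact hd l
    | succ k ih =>
      intro y
      have h1 := W.smul_mem (gen n q .a) (ih (gen n q .b ^ (n - 1) • y))
      rw [a_smul_pureTensor, a_smul_vec, ← mul_smul (gen n q .b),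
        mul_pow_sub_one hn0, (relations n q).bn, one_smul] at h1
      exact (W.add_mem_iff_left (ih _)).mp h1
  refine eq_top_of_pureTensor_mem W fun x y => ?_
  obtain ⟨r, rfl⟩ := eq_sum_vec i j x
  rw [map_sum, LinearMap.sum_apply]
  refine W.sum_mem fun p _ => ?_
  rw [map_smul, LinearMap.smul_apply]
  exact W.smul_of_tower_mem _ (ha _ _ _)

theorem cls_oneDim_mul_oneDim (i j i' j' : ℤ) :
    GreenRing.cls (oneDim n q i j) * GreenRing.cls (oneDim n q i' j') =
      GreenRing.cls (oneDim n q (i + i') (j + j')) := by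
  rw [GreenRing.cls_mul]
  let u := pureTensor _ _ (oneVec n q i j) (oneVec n q i' j')
  have hu : IsWeight n q (i + i') (j + j') u :=
    (isWeight_oneVec i j).pureTensor (isWeight_oneVec i' j')
  let f := oneDimHom hu
    (by rw [a_smul_pureTensor, a_smul_oneDim, a_smul_oneDim, map_zero, map_zero,
      LinearMap.zero_apply, add_zero])
    (by rw [d_smul_pureTensor, d_smul_oneDim, d_smul_oneDim, map_zero, map_zero,
      LinearMap.zero_apply, add_zero])
  refine (cls_eq_of_surjective f (LinearMap.range_eq_top.mp
    (eq_top_of_pureTensor_mem _ fun x y => ?_)) ?_).symm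
  · obtain ⟨r, rfl⟩ := oneDim_eq_smul i j x
    obtain ⟨s, rfl⟩ := oneDim_eq_smul i' j' y
    rw [map_smul, map_smul, LinearMap.smul_apply]
    exact (LinearMap.range f).smul_of_tower_mem s ((LinearMap.range f).smul_of_tower_mem r
      ⟨_, oneDimHom_oneVec hu _ _⟩)
  · rw [finrank_tensor, finrank_oneDim, finrank_oneDim, finrank_oneDim]

theorem cls_indProj_mul_oneDim (i j i' j' : ℤ) :
    GreenRing.cls (indProj n q i j) * GreenRing.cls (oneDim n q i' j') =
      GreenRing.cls (indProj n q (i + i') (j + j')) := by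
  rw [GreenRing.cls_mul]
  have h0 : IsWeight n q i j (vec n q i j 0 0) := by
    simpa using isWeight_vec (n := n) (q := q) i j 0 0
  let f := indProjHom (h0.pureTensor (isWeight_oneVec (n := n) (q := q) i' j'))
  refine (cls_eq_of_surjective f (LinearMap.range_eq_top.mp
    (eq_top_of_vec_pureTensor_mem _ fun y => ?_)) ?_).symm
  · obtain ⟨s, rfl⟩ := oneDim_eq_smul i' j' y
    rw [map_smul]
    exact (LinearMap.range f).smul_of_tower_mem s ⟨_, indProjHom_vec_zero _⟩
  · rw [finrank_tensor, finrank_oneDim, finrank_indProj, finrank_indProj, mul_one]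

/-- Here the first factor is killed by `a` and `d`, which therefore act through the second factor
alone and carry the generator to every basis vector. -/
theorem cls_oneDim_mul_indProj (i j i' j' : ℤ) :
    GreenRing.cls (oneDim n q i j) * GreenRing.cls (indProj n q i' j') =
      GreenRing.cls (indProj n q (i + i') (j + j')) := by
  rw [GreenRing.cls_mul]
  have h0 : IsWeight n q i' j' (vec n q i' j' 0 0) := by
    simpa using isWeight_vec (n := n) (q := q) i' j' 0 0
  let f := indProjHom ((isWeight_oneVec (n := n) (q := q) i j).pureTensor h0)
  have hd : ∀ l, pureTensor _ _ (oneVec n q i j) (vec n q i' j' 0 l) ∈ LinearMap.range f := by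
    intro l
    induction l with
    | zero => exact ⟨_, indProjHom_vec_zero _⟩
    | succ l ih =>
      have h1 := (LinearMap.range f).smul_mem (gen n q .d) ih
      rwa [d_smul_pureTensor, d_smul_oneDim, map_zero, LinearMap.zero_apply, zero_add, d_smul_vec,
        pow_zero, one_smul] at h1
  have ha : ∀ k l, pureTensor _ _ (oneVec n q i j) (vec n q i' j' k l) ∈ LinearMap.range f := by
    intro k l
    induction k with
    | zero => exact hd l
    | succ k ih =>
      have h1 := (LinearMap.range f).smul_mem (gen n q .a) ih
      rwa [a_smul_pureTensor, a_smul_oneDim, map_zero, LinearMap.zero_apply, zero_add,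
        a_smul_vec] at h1
  refine (cls_eq_of_surjective f (LinearMap.range_eq_top.mp
    (eq_top_of_pureTensor_mem _ fun x y => ?_)) ?_).symm
  · obtain ⟨s, rfl⟩ := oneDim_eq_smul i j x
    obtain ⟨r, rfl⟩ := eq_sum_vec i' j' y
    rw [map_smul, LinearMap.smul_apply, map_sum]
    refine (LinearMap.range f).smul_of_tower_mem s (Submodule.sum_mem _ fun p _ => ?_)
    rw [map_smul]
    exact (LinearMap.range f).smul_of_tower_mem _ (ha _ _)
  · rw [finrank_tensor, finrank_oneDim, finrank_indProj, finrank_indProj, one_mul]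

/-- Each vector `u ⊗ a ^ k d ^ l u` has weight `(k - l, k - l)` and so receives a map from the
corresponding `indProj`. Together these maps are surjective, since `u ⊗ P` generates, and both sides
have dimension `n ^ 4`. -/
theorem cls_indProj_mul_indProj :
    GreenRing.cls (indProj n q 0 0) * GreenRing.cls (indProj n q 0 0) =
      ∑ p : Fin n × Fin n, GreenRing.cls (indProj n q (p.1 - p.2) (p.1 - p.2)) := by
  rw [GreenRing.cls_mul, ← GreenRing.cls_pi]
  have h0 : IsWeight n q 0 0 (vec n q 0 0 0 0) := by
    simpa using isWeight_vec (n := n) (q := q) 0 0 0 0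
  have hw : ∀ p : Fin n × Fin n, IsWeight n q (p.1 - p.2 : ℤ) (p.1 - p.2 : ℤ)
      (pureTensor _ _ (vec n q 0 0 0 0) (vec n q 0 0 p.1 p.2)) := fun p => by
    simpa using h0.pureTensor (isWeight_vec (n := n) (q := q) 0 0 p.1 p.2)
  let f : FDModule.pi (fun p : Fin n × Fin n => indProj n q (p.1 - p.2 : ℤ) (p.1 - p.2 : ℤ))
      →ₗ[HnZero n q] (indProj n q 0 0).tensor (indProj n q 0 0) :=
    LinearMap.lsum (HnZero n q) (fun p : Fin n × Fin n =>
      (indProj n q (p.1 - p.2 : ℤ) (p.1 - p.2 : ℤ) : Type u)) ℕ fun p => indProjHom (hw p)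
  refine (cls_eq_of_surjective f (LinearMap.range_eq_top.mp
    (eq_top_of_vec_pureTensor_mem _ fun y => ?_)) ?_).symm
  · obtain ⟨r, rfl⟩ := eq_sum_vec 0 0 y
    rw [map_sum]
    refine Submodule.sum_mem _ fun p _ => ?_
    rw [map_smul]
    refine (LinearMap.range f).smul_of_tower_mem _ ⟨Pi.single p (vec n q _ _ 0 0), ?_⟩
    exact (LinearMap.lsum_piSingle (R := HnZero n q) (φ := fun p : Fin n × Fin n =>
      (indProj n q (p.1 - p.2 : ℤ) (p.1 - p.2 : ℤ) : Type u)) ℕ (fun p => indProjHom (hw p)) p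
      _).trans (indProjHom_vec_zero (hw p))
  · rw [finrank_tensor, finrank_indProj]
    refine (Module.finrank_pi_fintype K (M := fun p : Fin n × Fin n =>
      (indProj n q (p.1 - p.2 : ℤ) (p.1 - p.2 : ℤ) : Type u))).trans ?_
    simp [finrank_indProj]

end

end HnZero

/-! ## Rings with the presentation `classIdeal` -/

section Presentation

variable (n : ℕ)

/-- The class of a variable in the quotient by `classIdeal`. -/
noncomputable def classVar (i : Fin 3) : MvPolynomial (Fin 3) ℤ ⧸ classIdeal n :=
  Ideal.Quotient.mk _ (MvPolynomial.X i)

theorem classVar_zero_pow : classVar n 0 ^ n = 1 := by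
  rw [← sub_eq_zero, classVar, ← map_pow, ← map_one (Ideal.Quotient.mk (classIdeal n)), ← map_sub,
    Ideal.Quotient.eq_zero_iff_mem]
  exact Ideal.subset_span (by simp)

theorem classVar_one_pow : classVar n 1 ^ n = 1 := by
  rw [← sub_eq_zero, classVar, ← map_pow, ← map_one (Ideal.Quotient.mk (classIdeal n)), ← map_sub,
    Ideal.Quotient.eq_zero_iff_mem]
  exact Ideal.subset_span (by simp)

theorem classVar_two_sq :
    classVar n 2 ^ 2 = n * ∑ i ∈ Finset.range n, classVar n 0 ^ i * classVar n 2 := by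
  have h : Ideal.Quotient.mk (classIdeal n) (MvPolynomial.X 2 ^ 2 -
      (n : MvPolynomial (Fin 3) ℤ) * ∑ i ∈ Finset.range n, MvPolynomial.X 0 ^ i *
        MvPolynomial.X 2) = 0 :=
    Ideal.Quotient.eq_zero_iff_mem.mpr (Ideal.subset_span (by simp))
  simpa [sub_eq_zero, classVar] using h

/-- The monomials `xⁱ yʲ` and `xⁱ yʲ z` with `i, j < n`. -/
noncomputable def classMonomial :
    (Fin n × Fin n) ⊕ (Fin n × Fin n) → MvPolynomial (Fin 3) ℤ ⧸ classIdeal n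
  | .inl p => classVar n 0 ^ (p.1 : ℕ) * classVar n 1 ^ (p.2 : ℕ)
  | .inr p => classVar n 0 ^ (p.1 : ℕ) * classVar n 1 ^ (p.2 : ℕ) * classVar n 2

/-- The span contains `1` and is closed under multiplication by each variable, which is enough by
induction on polynomials. -/
theorem span_classMonomial (hn : n ≠ 0) :
    Submodule.span ℤ (Set.range (classMonomial n)) = ⊤ := by
  set W := Submodule.span ℤ (Set.range (classMonomial n)) with hW
  have hx := fun i => pow_eq_pow_mod i (classVar_zero_pow n)
  have hy := fun i => pow_eq_pow_mod i (classVar_one_pow n)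
  have hlt : ∀ i, i % n < n := fun i => Nat.mod_lt _ (Nat.pos_of_ne_zero hn)
  have h1 : ∀ i j, classVar n 0 ^ i * classVar n 1 ^ j ∈ W := fun i j => by
    rw [hx i, hy j]
    exact Submodule.subset_span ⟨.inl (⟨_, hlt i⟩, ⟨_, hlt j⟩), rfl⟩
  have h2 : ∀ i j, classVar n 0 ^ i * classVar n 1 ^ j * classVar n 2 ∈ W := fun i j => by
    rw [hx i, hy j]
    exact Submodule.subset_span ⟨.inr (⟨_, hlt i⟩, ⟨_, hlt j⟩), rfl⟩
  have hmul : ∀ k, ∀ w ∈ W, w * classVar n k ∈ W := by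
    intro k w hw
    induction hw using Submodule.span_induction with
    | zero => rw [zero_mul]; exact W.zero_mem
    | add x y _ _ hx hy => rw [add_mul]; exact W.add_mem hx hy
    | smul r x _ hx => rw [smul_mul_assoc]; exact W.smul_mem r hx
    | mem w hw =>
      obtain ⟨p | p, rfl⟩ := hw <;> rw [classMonomial]
      · fin_cases k
        · change _ * classVar n 0 ∈ W
          rw [mul_right_comm, ← pow_succ]
          exact h1 _ _
        · change _ * classVar n 1 ∈ W
          rw [mul_assoc, ← pow_succ]
          exact h1 _ _
        · exact h2 _ _
      · fin_cases k
        · change _ * classVar n 0 ∈ W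
          rw [mul_right_comm, mul_right_comm (classVar n 0 ^ _), ← pow_succ]
          exact h2 _ _
        · change _ * classVar n 1 ∈ W
          rw [mul_right_comm, mul_assoc (classVar n 0 ^ _), ← pow_succ]
          exact h2 _ _
        · change _ * classVar n 2 ∈ W
          -- The relation for the square of `z` is the only one that lowers the degree in `z`; it
          -- leaves a combination of monomials with a single factor `z`.
          rw [mul_assoc, ← sq, classVar_two_sq, mul_left_comm, ← nsmul_eq_mul, Finset.mul_sum]
          refine W.nsmul_mem (W.sum_mem fun m _ => ?_) n
          rw [← mul_assoc, mul_right_comm (classVar n 0 ^ _), ← pow_add]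
          exact h2 _ _
  refine eq_top_iff.mpr fun w _ => ?_
  obtain ⟨p, rfl⟩ := Ideal.Quotient.mk_surjective w
  induction p using MvPolynomial.induction_on with
  | C a =>
    have h := W.smul_mem a (h1 0 0)
    rw [pow_zero, pow_zero, mul_one] at h
    convert h
    simp
  | add p p' h h' => rw [map_add]; exact W.add_mem (h trivial) (h' trivial)
  | mul_X p k h => rw [map_mul]; exact hmul k _ (h trivial)

open scoped IsMulCommutative in
/-- Three commuting elements that satisfy the relations, and no linear relation between the
monomials `xⁱ yʲ`, `xⁱ yʲ z` with `i, j < n`, generate a ring presented by `classIdeal`. -/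
theorem exists_classIdeal_equiv (hn : n ≠ 0) {G : Type*} [Ring G] {x y z : G} {R : Subring G}
    (hR : R = Subring.closure {x, y, z}) (hxy : x * y = y * x)
    (hxz : x * z = z * x) (hyz : y * z = z * y) (hx : x ^ n = 1) (hy : y ^ n = 1)
    (hz : z ^ 2 = n * ∑ i ∈ Finset.range n, x ^ i * z)
    (hind : ∀ α β : Fin n × Fin n → ℤ, ∑ p, α p • (x ^ (p.1 : ℕ) * y ^ (p.2 : ℕ)) +
      ∑ p, β p • (x ^ (p.1 : ℕ) * y ^ (p.2 : ℕ) * z) = 0 → α = 0 ∧ β = 0) :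
    ∃ e : (MvPolynomial (Fin 3) ℤ ⧸ classIdeal n) ≃+* R,
      (e (classVar n 0) : G) = x ∧ (e (classVar n 1) : G) = y ∧ (e (classVar n 2) : G) = z := by
  -- The ring `G` need not be commutative, but `R` is generated by commuting elements, so
  -- polynomials can be evaluated in it.
  have : IsMulCommutative R := hR ▸ Subring.isMulCommutative_closure (by
    rintro u (rfl | rfl | rfl) v (rfl | rfl | rfl) <;> first | rfl | assumption |
      (symm; assumption))
  let x' : R := ⟨x, hR ▸ Subring.subset_closure (by simp)⟩
  let y' : R := ⟨y, hR ▸ Subring.subset_closure (by simp)⟩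
  let z' : R := ⟨z, hR ▸ Subring.subset_closure (by simp)⟩
  let φ : MvPolynomial (Fin 3) ℤ →+* R := MvPolynomial.eval₂Hom (Int.castRingHom R) ![x', y', z']
  have hφ0 : φ (MvPolynomial.X 0) = x' := by simp [φ]
  have hφ1 : φ (MvPolynomial.X 1) = y' := by simp [φ]
  have hφ2 : φ (MvPolynomial.X 2) = z' := by simp [φ]
  have hker : ∀ a ∈ classIdeal n, φ a = 0 := by
    intro a ha
    have hle : classIdeal n ≤ RingHom.ker φ := by
      rw [classIdeal, Ideal.span_le]
      rintro _ (rfl | rfl | rfl) <;> rw [SetLike.mem_coe, RingHom.mem_ker, map_sub, sub_eq_zero]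
      · rw [map_pow, hφ0, map_one]
        exact Subtype.ext hx
      · rw [map_pow, hφ1, map_one]
        exact Subtype.ext hy
      · simp only [map_pow, map_mul, map_sum, map_natCast, hφ0, hφ2]
        refine Subtype.ext ?_
        simpa using hz
    exact hle ha
  let ψ : (MvPolynomial (Fin 3) ℤ ⧸ classIdeal n) →+* R := Ideal.Quotient.lift _ φ hker
  have hψ0 : ψ (classVar n 0) = x' := (Ideal.Quotient.lift_mk _ _ _).trans hφ0
  have hψ1 : ψ (classVar n 1) = y' := (Ideal.Quotient.lift_mk _ _ _).trans hφ1
  have hψ2 : ψ (classVar n 2) = z' := (Ideal.Quotient.lift_mk _ _ _).trans hφ2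
  -- Every element of the quotient is a combination of the spanning monomials, and independence of
  -- their images forces its coefficients to vanish. So the monomials need not be known in advance
  -- to be independent in the quotient.
  have hinj : Function.Injective ψ := by
    refine (injective_iff_map_eq_zero ψ).mpr fun w hw => ?_
    obtain ⟨c, rfl⟩ := (Submodule.mem_span_range_iff_exists_fun ℤ).mp
      (span_classMonomial n hn ▸ Submodule.mem_top :
        w ∈ Submodule.span ℤ (Set.range (classMonomial n)))
    have h := congrArg (Subtype.val : R → G) hw
    rw [Fintype.sum_sum_type] at h
    simp only [classMonomial, map_add, map_sum, map_zsmul, map_mul, map_pow, hψ0, hψ1, hψ2] at h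
    obtain ⟨h1, h2⟩ := hind (fun p => c (.inl p)) (fun p => c (.inr p)) (by
      simpa [x', y', z'] using h)
    refine Finset.sum_eq_zero fun p _ => ?_
    rcases p with p | p
    · rw [congrFun h1 p, Pi.zero_apply, zero_smul]
    · rw [congrFun h2 p, Pi.zero_apply, zero_smul]
  have hsurj : Function.Surjective ψ := by
    have h : R ≤ (R.subtype.comp ψ).range := by
      refine hR.le.trans (Subring.closure_le.mpr ?_)
      rintro _ (rfl | rfl | rfl)
      · exact ⟨classVar n 0, congrArg Subtype.val hψ0⟩
      · exact ⟨classVar n 1, congrArg Subtype.val hψ1⟩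
      · exact ⟨classVar n 2, congrArg Subtype.val hψ2⟩
    rintro ⟨g, hg⟩
    obtain ⟨w, hw⟩ := h hg
    exact ⟨w, Subtype.ext hw⟩
  exact ⟨RingEquiv.ofBijective ψ ⟨hinj, hsurj⟩, congrArg Subtype.val hψ0, congrArg Subtype.val hψ1,
    congrArg Subtype.val hψ2⟩

end Presentation

namespace HnZero

noncomputable section

/-- The monomial `x ^ i y ^ j` corresponds to the weight `(i, i + j)`. The second coordinate is
recovered by subtracting the first, and residues in `[0, n)` are determined by their classes. -/
theorem weight_eq_iff {n : ℕ} (p r : Fin n × Fin n) :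
    ((n : ℤ) ∣ (p.1 : ℕ) - (r.1 : ℕ) ∧
      (n : ℤ) ∣ ((p.1 : ℕ) + (p.2 : ℕ)) - ((r.1 : ℕ) + (r.2 : ℕ))) ↔ p = r := by
  constructor
  · rintro ⟨h1, h2⟩
    have h3 : ∀ i j : Fin n, (n : ℤ) ∣ (i : ℕ) - (j : ℕ) → i = j := by
      intro i j h
      have := Int.eq_zero_of_abs_lt_dvd h (by
        rw [abs_lt]
        have := i.2
        have := j.2
        omega)
      exact Fin.ext (by omega)
    refine Prod.ext (h3 _ _ h1) (h3 _ _ ?_)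
    have h4 := dvd_sub h2 h1
    rwa [add_sub_add_comm, add_sub_cancel_left] at h4
  · rintro rfl
    simp

variable {K : Type u} [Field K] {n : ℕ} {q : K} [hn : Fact (2 < n)]
  [hq : Fact (IsPrimitiveRoot q n)]

/-! ## Relations in the Green ring -/

theorem cls_oneDim_zero : GreenRing.cls (oneDim n q 0 0) = 1 := by
  rw [← trivial_eq_oneDim, GreenRing.cls_trivial]

theorem cls_oneDim_pow (i j : ℤ) (m : ℕ) :
    GreenRing.cls (oneDim n q i j) ^ m = GreenRing.cls (oneDim n q (m * i) (m * j)) := by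
  induction m with
  | zero => simp [cls_oneDim_zero]
  | succ m ih =>
    rw [pow_succ, ih, cls_oneDim_mul_oneDim]
    push_cast
    rw [add_one_mul, add_one_mul]

theorem cls_oneDim_pow_self (i j : ℤ) : GreenRing.cls (oneDim n q i j) ^ n = 1 := by
  rw [cls_oneDim_pow, ← cls_oneDim_zero, oneDim_congr] <;> simp

theorem cls_oneDim_monomial (i j : ℕ) :
    GreenRing.cls (oneDim n q 1 1) ^ i * GreenRing.cls (oneDim n q 0 1) ^ j =
      GreenRing.cls (oneDim n q i (i + j)) := by
  rw [cls_oneDim_pow, cls_oneDim_pow, cls_oneDim_mul_oneDim]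
  simp

theorem cls_indProj_monomial (i j : ℕ) :
    GreenRing.cls (oneDim n q 1 1) ^ i * GreenRing.cls (oneDim n q 0 1) ^ j *
      GreenRing.cls (indProj n q 0 0) = GreenRing.cls (indProj n q i (i + j)) := by
  rw [cls_oneDim_monomial, cls_oneDim_mul_indProj, add_zero, add_zero]

/-- The summand `[P_{k-l,k-l}]` is `x ^ (k - l) z`. For each fixed `l` the exponents `k - l` run
over all residues modulo `n`, so the double sum is `n` copies of `∑ x ^ i z`. -/
theorem cls_indProj_sq : GreenRing.cls (indProj n q 0 0) ^ 2 =
    n * ∑ i ∈ Finset.range n, GreenRing.cls (oneDim n q 1 1) ^ i *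
      GreenRing.cls (indProj n q 0 0) := by
  have hpow := cls_oneDim_pow_self (n := n) (q := q) 1 1
  -- The exponent `(n - 1) * l` stands for `-l`, as `x ^ n = 1`.
  have hterm : ∀ k l : ℕ, GreenRing.cls (indProj n q (k - l : ℤ) (k - l : ℤ)) =
      GreenRing.cls (oneDim n q 1 1) ^ k * GreenRing.cls (oneDim n q 1 1) ^ ((n - 1) * l) *
        GreenRing.cls (indProj n q 0 0) := by
    intro k l
    have h1 : (1 : ℕ) ≤ n := Nat.one_le_iff_ne_zero.mpr (ne_zero_of_fact (n := n))
    have h2 : (n : ℤ) ∣ ((k - l : ℤ)) - ((k + (n - 1) * l : ℕ) * 1 : ℤ) :=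
      ⟨-l, by push_cast [Nat.cast_sub h1]; ring⟩
    rw [← pow_add, cls_oneDim_pow, ← oneDim_congr h2 h2, cls_oneDim_mul_indProj, add_zero]
  rw [sq, cls_indProj_mul_indProj, Fintype.sum_prod_type_right]
  generalize GreenRing.cls (oneDim n q 1 1) = x at hpow hterm ⊢
  generalize GreenRing.cls (indProj n q 0 0) = z at hterm ⊢
  -- The geometric sum absorbs powers of `x`, because `(∑ x ^ i) (x - 1) = x ^ n - 1 = 0`.
  have hg : ∀ m : ℕ, (∑ i ∈ Finset.range n, x ^ i) * x ^ m = ∑ i ∈ Finset.range n, x ^ i := by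
    intro m
    induction m with
    | zero => rw [pow_zero, mul_one]
    | succ m ih =>
      have h := geom_sum_mul x n
      rw [hpow, sub_self, mul_sub, mul_one, sub_eq_zero] at h
      rw [pow_succ, ← mul_assoc, ih, h]
  have hinner : ∀ l : Fin n, ∑ k : Fin n, GreenRing.cls (indProj n q (k - l : ℤ) (k - l : ℤ)) =
      ∑ i ∈ Finset.range n, x ^ i * z := by
    intro l
    rw [Finset.sum_congr rfl fun (k : Fin n) _ => hterm k l,
      Fin.sum_univ_eq_sum_range (fun k => x ^ k * x ^ ((n - 1) * (l : ℕ)) * z) n,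
      ← Finset.sum_mul, ← Finset.sum_mul, hg, Finset.sum_mul]
  rw [Finset.sum_congr rfl fun l _ => hinner l, Finset.sum_const, Finset.card_univ,
    Fintype.card_fin, nsmul_eq_mul]

/-! ## Linear independence of the classes -/

theorem rankOf_weightProj_oneDim (i j k l : ℤ) :
    (oneDim n q i j).rankOf (weightProj n q k l) =
      if (n : ℤ) ∣ i - k ∧ (n : ℤ) ∣ j - l then 1 else 0 := by
  have h : Algebra.lsmul K K (oneDim n q i j) (weightProj n q k l) =
      if (n : ℤ) ∣ i - k ∧ (n : ℤ) ∣ j - l then LinearMap.id else 0 := by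
    refine LinearMap.ext fun x => ?_
    obtain ⟨r, rfl⟩ := oneDim_eq_smul i j x
    rw [map_smul, Algebra.lsmul_apply, weightProj_smul (isWeight_oneVec i j)]
    split_ifs <;> simp
  by_cases hc : (n : ℤ) ∣ i - k ∧ (n : ℤ) ∣ j - l
  · rw [if_pos hc] at h ⊢
    rw [FDModule.rankOf, h, LinearMap.range_id, finrank_top, finrank_oneDim]
  · rw [if_neg hc] at h ⊢
    rw [FDModule.rankOf, h, LinearMap.range_zero, finrank_bot]

variable (n q) in
/-- An element that annihilates the one-dimensional modules and has rank one on the projective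
cover of the one-dimensional module of weight `(k, l)`. -/
def socleElt (k l : ℤ) : HnZero n q :=
  gen n q .a ^ (n - 1) * gen n q .d ^ (n - 1) * weightProj n q k l

theorem rankOf_socleElt_oneDim (i j k l : ℤ) :
    (oneDim n q i j).rankOf (socleElt n q k l) = 0 := by
  have h : Algebra.lsmul K K (oneDim n q i j) (socleElt n q k l) = 0 := by
    refine LinearMap.ext fun x => ?_
    -- At least one factor `d` is present since `n - 1 > 0`, and it kills the one-dimensional
    -- module.
    obtain ⟨m, hm⟩ : ∃ m, n - 1 = m + 1 := ⟨n - 2, by have := hn.out; omega⟩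
    rw [Algebra.lsmul_apply, socleElt, hm, mul_smul, mul_smul, pow_succ' (gen n q .d), mul_smul,
      d_smul_oneDim, smul_zero, LinearMap.zero_apply]
  rw [FDModule.rankOf, h, LinearMap.range_zero, finrank_bot]

theorem vec_ne_zero (i j : ℤ) {k l : ℕ} (hk : k < n) (hl : l < n) : vec n q i j k l ≠ 0 := by
  rw [vec, LinearEquiv.map_ne_zero_iff, gridVec, dif_pos ⟨hk, hl⟩]
  simp

/-- The factor `a ^ (n - 1) d ^ (n - 1)` pushes every basis vector other than the generator off the
grid, and the weight projector then tests the weight of the generator. -/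
theorem socleElt_smul_vec (i j k l : ℤ) (r s : ℕ) : socleElt n q k l • vec n q i j r s =
    if ((n : ℤ) ∣ i - k ∧ (n : ℤ) ∣ j - l) ∧ r = 0 ∧ s = 0 then vec n q i j (n - 1) (n - 1)
    else 0 := by
  have hv : gen n q .a ^ (n - 1) • gen n q .d ^ (n - 1) • vec n q i j r s =
      if r = 0 ∧ s = 0 then vec n q i j (n - 1) (n - 1) else 0 := by
    rw [d_pow_smul_vec, smul_comm_gen, a_pow_smul_vec]
    split_ifs with h
    · rw [h.1, h.2, zero_mul, pow_zero, one_smul, zero_add]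
    · have := hn.out
      rw [vec_eq_zero i j (by omega), smul_zero]
  rw [socleElt, mul_smul, mul_smul, weightProj_smul (isWeight_vec i j r s)]
  by_cases hrs : r = 0 ∧ s = 0
  · obtain ⟨rfl, rfl⟩ := hrs
    simp only [Nat.cast_zero, add_zero, sub_zero, and_self, and_true]
    split_ifs
    · simp [hv]
    · simp
  · simp only [hrs, and_false, if_false]
    split_ifs
    · rw [hv, if_neg hrs]
    · simp

theorem rankOf_socleElt_indProj (i j k l : ℤ) :
    (indProj n q i j).rankOf (socleElt n q k l) =
      if (n : ℤ) ∣ i - k ∧ (n : ℤ) ∣ j - l then 1 else 0 := by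
  have h1 : 0 < n := by have := hn.out; omega
  have hrange : LinearMap.range (Algebra.lsmul K K (indProj n q i j) (socleElt n q k l)) =
      if (n : ℤ) ∣ i - k ∧ (n : ℤ) ∣ j - l then K ∙ vec n q i j (n - 1) (n - 1) else ⊥ := by
    apply le_antisymm
    · rintro _ ⟨x, rfl⟩
      obtain ⟨c, rfl⟩ := eq_sum_vec i j x
      rw [map_sum]
      refine Submodule.sum_mem _ fun p _ => ?_
      rw [map_smul, Algebra.lsmul_apply, socleElt_smul_vec]
      refine Submodule.smul_mem _ _ ?_
      by_cases h : (n : ℤ) ∣ i - k ∧ (n : ℤ) ∣ j - l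
      · rw [if_pos h]
        split_ifs
        · exact Submodule.mem_span_singleton_self _
        · exact Submodule.zero_mem _
      · rw [if_neg h, if_neg fun h' => h h'.1]
        exact Submodule.zero_mem _
    · split_ifs with h
      · rw [Submodule.span_singleton_le_iff_mem]
        refine ⟨vec n q i j 0 0, ?_⟩
        rw [Algebra.lsmul_apply, socleElt_smul_vec, if_pos ⟨h, rfl, rfl⟩]
      · exact bot_le
  by_cases hc : (n : ℤ) ∣ i - k ∧ (n : ℤ) ∣ j - l
  · rw [if_pos hc] at hrange ⊢
    rw [FDModule.rankOf, hrange]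
    exact finrank_span_singleton (vec_ne_zero (n := n) (q := q) i j (by omega) (by omega))
  · rw [if_neg hc] at hrange ⊢
    rw [FDModule.rankOf, hrange, finrank_bot]

/-- The argument is triangular. The rank of `socleElt` vanishes on the one-dimensional modules and
isolates one coefficient of `β`. Once `β = 0`, the rank of `weightProj` isolates one coefficient of
`α`, and its value on the projective modules is irrelevant. -/
theorem cls_linear_independent (α β : Fin n × Fin n → ℤ)
    (h : ∑ p, α p • GreenRing.cls (oneDim n q (p.1 : ℕ) ((p.1 : ℕ) + (p.2 : ℕ))) +
      ∑ p, β p • GreenRing.cls (indProj n q (p.1 : ℕ) ((p.1 : ℕ) + (p.2 : ℕ))) = 0) :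
    α = 0 ∧ β = 0 := by
  have hβ : β = 0 := funext fun r => by
    obtain ⟨φ, hφ⟩ := GreenRing.exists_rankHom (K := K)
      (socleElt n q (r.1 : ℕ) ((r.1 : ℕ) + (r.2 : ℕ)))
    have h1 := congrArg φ h
    simp only [map_add, map_sum, map_zsmul, hφ, rankOf_socleElt_oneDim, rankOf_socleElt_indProj,
      weight_eq_iff, map_zero] at h1
    simpa using h1
  refine ⟨funext fun r => ?_, hβ⟩
  obtain ⟨φ, hφ⟩ := GreenRing.exists_rankHom (K := K)
    (weightProj n q (r.1 : ℕ) ((r.1 : ℕ) + (r.2 : ℕ)))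
  have h1 := congrArg φ h
  simp only [hβ, Pi.zero_apply, zero_smul, Finset.sum_const_zero, add_zero, map_sum, map_zsmul, hφ,
    rankOf_weightProj_oneDim, weight_eq_iff, map_zero] at h1
  simpa using h1

/-! ## Generators of the projective class ring -/

/-- Classes of simple modules are monomials in `x` and `y`, and classes of projective modules are
sums of such monomials times `z`. Conversely, the three generators are themselves classes of simple
or projective modules. -/
theorem projectiveClassRing_eq_closure [IsAlgClosed K] :
    projectiveClassRing K (HnZero n q) = Subring.closure {GreenRing.cls (oneDim n q 1 1),
      GreenRing.cls (oneDim n q 0 1), GreenRing.cls (indProj n q 0 0)} := by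
  apply le_antisymm
  · set R := Subring.closure {GreenRing.cls (oneDim n q 1 1),
      GreenRing.cls (oneDim n q 0 1), GreenRing.cls (indProj n q 0 0)} with hR
    have hS : ∀ i j, GreenRing.cls (oneDim n q i j) ∈ R := by
      intro i j
      have hpos : (0 : ℤ) < n := by have := hn.out; omega
      -- From `[S_{i,j}] = x ^ i y ^ (j - i)`, the integers `i` and `j - i` are reduced modulo `n`
      -- to obtain natural exponents.
      have h1 : (((i % n).toNat : ℕ) : ℤ) = i % n :=
        Int.toNat_of_nonneg (Int.emod_nonneg _ hpos.ne')
      have h2 : ((((j - i) % n).toNat : ℕ) : ℤ) = (j - i) % n :=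
        Int.toNat_of_nonneg (Int.emod_nonneg _ hpos.ne')
      have h3 : (n : ℤ) ∣ i - i % n := Int.dvd_self_sub_emod
      have h4 : (n : ℤ) ∣ (j - i) - (j - i) % n := Int.dvd_self_sub_emod
      have h5 : (n : ℤ) ∣ j - (i % n + (j - i) % n) := by
        have := dvd_add h3 h4
        rwa [sub_add_sub_comm, add_sub_cancel] at this
      have h := cls_oneDim_monomial (n := n) (q := q) (i % n).toNat ((j - i) % n).toNat
      rw [h1, h2, ← oneDim_congr h3 h5] at h
      rw [← h]
      exact R.mul_mem (R.pow_mem (Subring.subset_closure (by simp)) _)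
        (R.pow_mem (Subring.subset_closure (by simp)) _)
    have hP : ∀ i j, GreenRing.cls (indProj n q i j) ∈ R := by
      intro i j
      have h := cls_oneDim_mul_indProj (n := n) (q := q) i j 0 0
      rw [add_zero, add_zero] at h
      rw [← h]
      exact R.mul_mem (hS i j) (Subring.subset_closure (by simp))
    rw [projectiveClassRing, Subring.closure_le]
    rintro _ ⟨M, hM | hM, rfl⟩
    · exact cls_projective_mem R.toAddSubgroup hP M hM
    · obtain ⟨i, j, ⟨e⟩⟩ := exists_equiv_oneDim M
      rw [GreenRing.cls_congr e]
      exact hS i j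
  · rw [Subring.closure_le]
    rintro _ (rfl | rfl | rfl)
    · exact Subring.subset_closure ⟨_, .inr (isSimpleModule_oneDim 1 1), rfl⟩
    · exact Subring.subset_closure ⟨_, .inr (isSimpleModule_oneDim 0 1), rfl⟩
    · exact Subring.subset_closure ⟨_, .inl (projective_indProj 0 0), rfl⟩

end

end HnZero

/-! ### The presentation of the projective class ring -/

theorem theorem4p9 {K : Type u} [Field K] [IsAlgClosed K] (n : ℕ) (q : K) [Fact (2 < n)]
    [Fact (IsPrimitiveRoot q n)] :
    ∃ e : (MvPolynomial (Fin 3) ℤ ⧸ classIdeal n) ≃+* projectiveClassRing K (HnZero n q),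
      (e (Ideal.Quotient.mk _ (MvPolynomial.X 0)) : GreenRing K (HnZero n q)) =
        GreenRing.cls (HnZero.simple n q 1 1) ∧
      (e (Ideal.Quotient.mk _ (MvPolynomial.X 1)) : GreenRing K (HnZero n q)) =
        GreenRing.cls (HnZero.simple n q 0 1) ∧
      (∃ P : FDModule K (HnZero n q), P.IsProjectiveCover (HnZero.simple n q 0 0)) ∧
      ∀ P : FDModule K (HnZero n q), P.IsProjectiveCover (HnZero.simple n q 0 0) →
        (e (Ideal.Quotient.mk _ (MvPolynomial.X 2)) : GreenRing K (HnZero n q)) =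
          GreenRing.cls P := by
  have hn2 : 2 < n := Fact.out
  have : Fact (1 < n) := ⟨by omega⟩
  have h11 : HnZero.simple n q 1 1 = HnZero.oneDim n q 1 1 := by
    rw [HnZero.simple_eq_oneDim, ZMod.val_one, Nat.cast_one]
  have h01 : HnZero.simple n q 0 1 = HnZero.oneDim n q 0 1 := by
    rw [HnZero.simple_eq_oneDim, ZMod.val_one, ZMod.val_zero, Nat.cast_one, Nat.cast_zero]
  have h00 : HnZero.simple n q 0 0 = HnZero.oneDim n q 0 0 := by
    rw [HnZero.simple_eq_oneDim, ZMod.val_zero, Nat.cast_zero]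
  have hcover := HnZero.isProjectiveCover_indProj (n := n) (q := q) 0 0
  rw [h11, h01, h00]
  obtain ⟨e, hx, hy, hz⟩ := exists_classIdeal_equiv n (by omega)
    (HnZero.projectiveClassRing_eq_closure (K := K) (n := n) (q := q))
    (x := GreenRing.cls (HnZero.oneDim n q 1 1)) (y := GreenRing.cls (HnZero.oneDim n q 0 1))
    (z := GreenRing.cls (HnZero.indProj n q 0 0))
    (by rw [HnZero.cls_oneDim_mul_oneDim, HnZero.cls_oneDim_mul_oneDim, add_comm, add_comm (1 : ℤ)])
    (by rw [HnZero.cls_oneDim_mul_indProj, HnZero.cls_indProj_mul_oneDim, add_comm])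
    (by rw [HnZero.cls_oneDim_mul_indProj, HnZero.cls_indProj_mul_oneDim, add_comm,
      add_comm (1 : ℤ)])
    (HnZero.cls_oneDim_pow_self 1 1) (HnZero.cls_oneDim_pow_self 0 1) HnZero.cls_indProj_sq
    (fun α β h => HnZero.cls_linear_independent (q := q) α β (by
      simp only [HnZero.cls_indProj_monomial] at h
      simpa only [HnZero.cls_oneDim_monomial] using h))
  refine ⟨e, hx, hy, ⟨_, hcover⟩, fun P hP => ?_⟩
  -- Uniqueness of projective covers makes the class of `P` independent of the chosen cover, so it
  -- may be computed with `indProj`.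
  obtain ⟨f⟩ := hcover.nonempty_equiv hP
  rw [← GreenRing.cls_congr f]
  exact hz
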